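/- **Setting (Directed-MCD).** Let $L(n)$ be the directed line network with nodes $1,\dots,n$ and edges $(i,i+1)$. Its time-line graph has the replicas $(v,t)$ ($v$ a node, $t\in\{0,1,2,\dots\}$) as vertices, and as edges the horizontal edges $((v,t),(v+1,t))$ and the arcs $((v,t),(v,t+1))$. Given an origin $v_0$ and a set $R=\{r_1,\dots,r_N\}$ of $N$ distinct requests, that is, replicas $r_i=(v_i,t_i)$ with $v_i\ge v_0$, ordered so that $t_1\le\dots\le t_N$, a feasible solution is a set $F$ of edges of the time-line graph that contains, for every $i$, a directed path from $(v_0,0)$ to $r_i$. Its cost is $|F|$, and $\mathrm{opt}(R)$ is the minimum cost of a feasible solution. A (deterministic) online algorithm knows $n$ and $v_0$ and starts with the solution that consists of the replica $(v_0,0)$ only. It receives the requests in order, and at the end of each time step $t<t_N$ a time event saying that no more requests for time $t$ will arrive. Its decisions depend only on the events seen so far. When a request $(v,t)$ arrives, it chooses a replica $(u,t)$, $u\le v$, of its current solution and adds the horizontal path from $(u,t)$ to $(v,t)$. At the time event of time $t$ it chooses a nonempty set of replicas $(w,t)$ of its current solution and adds the arcs $((w,t),(w,t+1))$. Edges are never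 deleted. The number of requests is not known to it in advance. The cost $\mathrm{cost}(A,R)$ of an algorithm $A$ is the number of edges in its solution after the last request. **Theorem.** There is an online algorithm $D$ for Directed-MCD that is $O\!\left(\min\left\{\frac{\log N}{\log\log N},\frac{\log n}{\log\log n}\right\}\right)$-competitive, and this is optimal up to a constant factor. Precisely: 1. There are an online algorithm $D$ (defined for all $n$ and $v_0$) and a constant $C>0$ such that for all $n\ge 3$, all origins $v_0$ and all sets $R$ of $N\ge 3$ requests, $$\mathrm{cost}(D,R)\le C\cdot\min\left\{\frac{\log N}{\log\log N},\frac{\log n}{\log\log n}\right\}\cdot\mathrm{opt}(R).$$ 2. There is a constant $c>0$ such that for all $n\ge 3$ and $N\ge 3$, every deterministic online algorithm $A$ on $L(n)$ with origin at the leftmost node, and every real $\rho$: if $\mathrm{cost}(A,R)\le\rho\cdot\mathrm{opt}(R)$ for all sets $R$ of at most $N$ requests, then $$\rho\ge c\cdot\min\left\{\frac{\log N}{\log\log N},\frac{\log n}{\log\log n}\right\}.$$ -/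

import Mathlib

namespace DMCD

/-- Replicas `(v, t)`: node `v` of the directed line network with nodes `0, …, n - 1`, at time `t`. -/
abbrev Replica (n : ℕ) := Fin n × ℕ

/-- A directed pair of replicas, from the first component to the second. -/
abbrev DirPair (n : ℕ) := Replica n × Replica n

/-- Horizontal directed edges `((v, t), (v + 1, t))` of the time-line graph. -/
def horizontalEdges (n : ℕ) : Set (DirPair n) :=
  {e | (e.1.1 : ℕ) + 1 = (e.2.1 : ℕ) ∧ e.1.2 = e.2.2}

/-- Arcs `((v, t), (v, t + 1))` of the time-line graph. -/
def arcs (n : ℕ) : Set (DirPair n) :=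
  {e | e.1.1 = e.2.1 ∧ e.1.2 + 1 = e.2.2}

/-- All directed edges of the time-line graph. -/
def edges (n : ℕ) : Set (DirPair n) := horizontalEdges n ∪ arcs n

/-- There is a directed path from `p` to `q` all of whose edges are in `F`. -/
def Reaches {n : ℕ} (F : Finset (DirPair n)) (p q : Replica n) : Prop :=
  Relation.ReflTransGen (fun a b => (a, b) ∈ F) p q

/-- An ordered set of requests for the origin `v₀`, with nondecreasing times. The requested nodes
are those that can be reached from the origin, i.e. the nodes `v ≥ v₀`. -/
structure Requests {n : ℕ} (v₀ : Fin n) where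
  list : List (Set.Ici v₀ × ℕ)
  nodup : list.Nodup
  sorted : list.Pairwise (fun r s => r.2 ≤ s.2)

/-- The number of requests. -/
def Requests.num {n : ℕ} {v₀ : Fin n} (R : Requests v₀) : ℕ := R.list.length

/-- `F` is a feasible solution: a set of edges of the time-line graph containing, for every
request, a directed path from the origin at time `0` to that request. -/
def IsFeasible {n : ℕ} {v₀ : Fin n} (R : Requests v₀) (F : Finset (DirPair n)) : Prop :=
  (F : Set (DirPair n)) ⊆ edges n ∧ ∀ r ∈ R.list, Reaches F (v₀, 0) (r.1.1, r.2)

/-- The minimum number of edges of a feasible solution. -/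
noncomputable def opt {n : ℕ} {v₀ : Fin n} (R : Requests v₀) : ℕ :=
  sInf {k | ∃ F : Finset (DirPair n), IsFeasible R F ∧ F.card = k}

/-- Events seen by an online algorithm: a request at a node, for the current time, or the time
event `tick`, which says that no further request for the current time will arrive. -/
inductive Event {n : ℕ} (v₀ : Fin n) where
  | request (v : Set.Ici v₀) : Event v₀
  | tick : Event v₀

/-- The current time after a history of events (in chronological order). -/
def clock {n : ℕ} {v₀ : Fin n} : List (Event v₀) → ℕ
  | [] => 0
  | Event.request _ :: h => clock h
  | Event.tick :: h => clock h + 1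

/-- The events produced by a list of requests if the current time is `t`; the input ends with the
last request. -/
def eventsFrom {n : ℕ} {v₀ : Fin n} : ℕ → List (Set.Ici v₀ × ℕ) → List (Event v₀)
  | _, [] => []
  | t, r :: l => List.replicate (r.2 - t) Event.tick ++ Event.request r.1 :: eventsFrom r.2 l

/-- The sequence of events of an ordered set of requests. -/
def Requests.events {n : ℕ} {v₀ : Fin n} (R : Requests v₀) : List (Event v₀) :=
  eventsFrom 0 R.list

/-- `(u, t)` is a replica of the solution `F`: it is the origin or an endpoint of an edge. -/
def HasCopy {n : ℕ} (v₀ : Fin n) (F : Finset (DirPair n)) (u : Fin n) (t : ℕ) : Prop :=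
  (u, t) = (v₀, 0) ∨ ∃ e ∈ F, e.1 = (u, t) ∨ e.2 = (u, t)

/-- The edges of the horizontal path from `(u, t)` to `(v, t)`. -/
def horizontalPath {n : ℕ} (u v : Fin n) (t : ℕ) : Finset (DirPair n) :=
  (Finset.univ.filter fun p : Fin n × Fin n => u ≤ p.1 ∧ (p.1 : ℕ) + 1 = (p.2 : ℕ) ∧ p.2 ≤ v).image
    fun p => ((p.1, t), (p.2, t))

/-- The arcs from `(w, t)` to `(w, t + 1)` for the nodes `w ∈ S`. -/
def storageArcs {n : ℕ} (S : Finset (Fin n)) (t : ℕ) : Finset (DirPair n) :=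
  S.image fun w => ((w, t), (w, t + 1))

/-- A deterministic online algorithm on the directed line network with `n` nodes and origin `v₀`.
It assigns to each history of events (in chronological order) the solution built so far.
A request at node `v` and the current time `t` has to be served at once by the horizontal path from
some replica `(u, t)` of the current solution; at a time event the algorithm selects a nonempty set
of nodes `w` with replica `(w, t)` in the current solution, and stores copies there until `t + 1`. -/
structure OnlineAlg {n : ℕ} (v₀ : Fin n) where
  sol : List (Event v₀) → Finset (DirPair n)
  sol_nil : sol [] = ∅
  sol_request : ∀ (h : List (Event v₀)) (v : Set.Ici v₀), ∃ u : Fin n,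
    u ≤ v.1 ∧ HasCopy v₀ (sol h) u (clock h) ∧
    sol (h ++ [Event.request v]) = sol h ∪ horizontalPath u v.1 (clock h)
  sol_tick : ∀ h : List (Event v₀), ∃ S : Finset (Fin n),
    S.Nonempty ∧ (∀ w ∈ S, HasCopy v₀ (sol h) w (clock h)) ∧
    sol (h ++ [Event.tick]) = sol h ∪ storageArcs S (clock h)

/-- The cost of an online algorithm: the number of edges of its solution after the last request. -/
def OnlineAlg.cost {n : ℕ} {v₀ : Fin n} (A : OnlineAlg v₀) (R : Requests v₀) : ℕ :=
  (A.sol R.events).card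

/-- `log x / log log x`; it is used for `x ≥ 3` only, where `log log x > 0`. -/
noncomputable def logRatio (x : ℕ) : ℝ := Real.log x / Real.log (Real.log x)

end DMCD

/-!
Both bounds rest on the equation `d ^ d = min N n`, whose solution `d` is of the order of
the claimed ratio.

**Upper bound.** Level `i` works at the scale `ρ i = d ^ i`, in space and in time. The algorithm
marks positions as active at a level for four scales of time and stores copies there. A level is
good for a request if it has an active copy between two and four scales to the left of it (or if the
origin is near enough), and fair if it has one within eight scales. If level `l` is the last one
that is not good, the request is served from level `l` at a cost of at most `8 ρ l` if that level is
fair, and otherwise from level `l + 1` at a cost of at most `4 d ρ l`; in the second case the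
request is *expensive* at level `l`, and active copies are set up on the grids of the levels `l - d, …, l`,
over a length of eight scales of level `l`. After any request, all levels are good at its position
(`good_update`).

Let `F` be an optimal solution. The last edges of the path in `F` to a request lie in or next to its
space-time cell of side `ρ i`, so the number of nonempty cells, times `ρ i`, is at most `4 |F|`
(`card_cells_mul_le`). Since two requests in the same cell cannot both have `l` as their last level
that is not good (`cells_ne`), each level costs `O(|F|)`, apart from the expensive requests and the
copies they set up; by the choice of the phase only `d` levels matter (`Trace.Window`), so that the
sum over the levels is `O(d |F|)`.

It remains to see that the expensive requests have total scale `O(|F|)`, summed over *all* `d`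
levels (`Trace.sum_exp_le`): their cost exceeds their scale by a factor `O(d)`. An expensive request
`k` of scale `ρ` ends a chain of requests in the interval `[X k, X k + ρ]` which follow each other
after at most `4 ρ` time, and nothing was requested shortly to the left of it meanwhile
(`Trace.Chain.no_left`), since such a request would have left a copy which the chain would have kept
alive. For each threshold `η < ρ` the request claims the edges at distance `2 ρ` to `4 ρ` on the
path to a representative of its chain (`Trace.IsRep`). Claims of the same level are disjoint
(`Trace.OnPiece.same_level`); a claim meets a given claim of a lower scale `ρ'` only for at most
`4 ρ'` of the `ρ` thresholds (`Trace.OnPiece.clash`). Averaging over the thresholds, each edge is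
claimed with total weight at most `1 + d * (4 / d) = 5`.

As `N` is not known, the algorithm runs in phases with `d = 16, 32, 64, …`. The costs of the phases
form a geometric series, which gives `cost_scaleAlg_le`.

**Lower bound.** The adversary uses `k` levels with scales `(4 k ^ 2) ^ l`. A front moves to the
right; level `l` adds its scale to it at the beginning of each of its periods of length
`k (4 k ^ 2) ^ l`, so that the front moves by about one per unit of time. The base of level `l` is a
position that the front passes at the beginning of the current period of the level, and the windows
of `3 k` period lengths to the left of the bases are disjoint (`base_add_lt`). At each time the
algorithm either stores a copy in each of the `k` windows, or the base of a level whose window it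
misses is requested. The latter costs the algorithm at least `3 k` period lengths, while the offline
solution, which follows the front, serves the request by waiting at the base for less than one
period (`opt_attackRequests_le`). Hence the ratio is of the order of `k`, where `(4 k ^ 2) ^ k`
steps are played.
-/

/-! ### Chains of requests -/

namespace DMCD

lemma grid_bounds {r g x : ℕ} (hr : 0 < r) (hg : g * r ≤ x) :
    (x / r - g) * r + g * r ≤ x ∧ x < (x / r - g) * r + (g + 1) * r := by
  have h1 : g * r ≤ x / r * r := Nat.mul_le_mul_right r ((Nat.le_div_iff_mul_le hr).2 hg)
  have h2 := Nat.div_mul_le_self x r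
  have h3 := Nat.lt_div_mul_add (a := x) hr
  rw [Nat.sub_mul, add_mul]
  omega

/-- The part of a run of the algorithm on which the bound for expensive requests rests, with all
geometry forgotten. The requests have indices in `K`, relative positions `X` and times `T`.
Level `l` has scale `δ ^ l`; before request `k`, the copy of level `l` at position `p` is active at
time `t` iff `t < a k l p`. `exp k l` says that request `k` is expensive at level `l`.
The field `exp_none` says that a level is not fair for a request that is expensive at it, `refresh`
that a request prolongs active copies shortly to the left, `near` that after a request all levels
are good at its position, and `fill` that an expensive request sets up copies on the grids of the
levels below. -/
structure Trace where
  δ : ℕ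
  K : Finset ℕ
  X : ℕ → ℕ
  T : ℕ → ℕ
  a : ℕ → ℕ → ℕ → ℕ
  exp : ℕ → ℕ → Prop
  twelve_le : 12 ≤ δ
  T_mono : ∀ i ∈ K, ∀ j ∈ K, i ≤ j → T i ≤ T j
  inj : ∀ i ∈ K, ∀ j ∈ K, X i = X j → T i = T j → i = j
  a_mono : ∀ i j, i ≤ j → ∀ l p, a i l p ≤ a j l p
  exp_mem : ∀ k l, exp k l → k ∈ K
  exp_unique : ∀ k l l', exp k l → exp k l' → l = l'
  exp_lt : ∀ k l, exp k l → 8 * δ ^ l < X k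
  exp_none : ∀ k l p, exp k l → T k < a k l p → p + 2 * δ ^ l ≤ X k → X k ≤ p + 8 * δ ^ l → False
  refresh : ∀ k ∈ K, ∀ l p, T k < a k l p → p ≤ X k → X k ≤ p + 9 * δ ^ l →
    T k + 4 * δ ^ l + 1 ≤ a (k + 1) l p
  near : ∀ k ∈ K, ∀ l, X k ≤ 4 * δ ^ l ∨
    ∃ p, T k + 4 * δ ^ l + 1 ≤ a (k + 1) l p ∧ p + 2 * δ ^ l ≤ X k ∧ X k ≤ p + 4 * δ ^ l
  fill : ∀ k l i p, exp k l → i ≤ l → l ≤ i + δ → δ ^ i ∣ p → p ≤ X k → X k ≤ p + 8 * δ ^ l →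
    T k + 4 * δ ^ i + 1 ≤ a (k + 1) i p

namespace Trace

variable (S : Trace)

/-- The scale of level `l`. -/
def ρ (l : ℕ) : ℕ := S.δ ^ l

lemma ρ_pos (l : ℕ) : 0 < S.ρ l := pow_pos (by have := S.twelve_le; omega) l

lemma ρ_mul_le {i l : ℕ} (h : i < l) : S.ρ i * S.δ ≤ S.ρ l := by
  unfold ρ; rw [← pow_succ]
  exact Nat.pow_le_pow_right (by have := S.twelve_le; omega) h

lemma twelve_mul_le {i l : ℕ} (h : i < l) : 12 * S.ρ i ≤ S.ρ l := by
  have := S.ρ_mul_le h; have := S.twelve_le; nlinarith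

/-- Request `c` belongs to the chain of request `k` at level `l`: it lies at most one scale to the
right of `k`, and from `c` on every request in this interval is followed by another one after at
most four scales of time, until `k` is reached. -/
def Chain (k l c : ℕ) : Prop :=
  c ∈ S.K ∧ c ≤ k ∧ S.X k ≤ S.X c ∧ S.X c ≤ S.X k + S.ρ l ∧
    ∀ j ∈ S.K, c ≤ j → j < k → S.X k ≤ S.X j → S.X j ≤ S.X k + S.ρ l →
      ∃ j' ∈ S.K, j < j' ∧ j' ≤ k ∧ S.X k ≤ S.X j' ∧ S.X j' ≤ S.X k + S.ρ l ∧
        S.T j' ≤ S.T j + 4 * S.ρ l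

variable {S}

lemma chain_self {k l : ℕ} (hk : k ∈ S.K) : S.Chain k l k :=
  ⟨hk, le_rfl, le_rfl, by omega, fun j _ h1 h2 => by omega⟩

lemma Chain.upward {k l c j : ℕ} (hc : S.Chain k l c) (hj : j ∈ S.K) (hcj : c ≤ j) (hjk : j ≤ k)
    (h1 : S.X k ≤ S.X j) (h2 : S.X j ≤ S.X k + S.ρ l) : S.Chain k l j :=
  ⟨hj, hjk, h1, h2, fun i hi h3 => hc.2.2.2.2 i hi (hcj.trans h3)⟩

/-- An earlier request in the interval that is not in the chain is much older than the chain. -/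
lemma Chain.lt_of_not {k l c j : ℕ} (hc : S.Chain k l c) (hj : j ∈ S.K) (hjc : j < c)
    (h1 : S.X k ≤ S.X j) (h2 : S.X j ≤ S.X k + S.ρ l) (hn : ¬ S.Chain k l j) :
    S.T j + 4 * S.ρ l < S.T c := by
  by_contra hT
  apply hn
  refine ⟨hj, hjc.le.trans hc.2.1, h1, h2, fun i hi h3 h4 h5 h6 => ?_⟩
  by_cases hic : c ≤ i
  · exact hc.2.2.2.2 i hi hic h4 h5 h6
  · have := S.T_mono j hj i hi h3
    exact ⟨c, hc.1, by omega, hc.2.1, hc.2.2.1, hc.2.2.2.1, by omega⟩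

/-- The last index of the interval in `[m, b]`, together with the next chain element. -/
lemma Chain.exists_last {k l m b : ℕ} (hm : S.Chain k l m) (hmb : m ≤ b) (hbk : b < k) :
    ∃ i j', S.Chain k l i ∧ m ≤ i ∧ i ≤ b ∧ S.Chain k l j' ∧ b < j' ∧
      S.T j' ≤ S.T i + 4 * S.ρ l := by
  classical
  let s := S.K.filter fun i => m ≤ i ∧ i ≤ b ∧ S.X k ≤ S.X i ∧ S.X i ≤ S.X k + S.ρ l
  have hs : s.Nonempty := ⟨m, by simp [s, hm.1, hmb, hm.2.2.1, hm.2.2.2.1]⟩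
  have hi := s.max'_mem hs
  set i := s.max' hs with hidef
  simp only [s, Finset.mem_filter] at hi
  obtain ⟨hiK, h1, h2, h3, h4⟩ := hi
  obtain ⟨j', hj'K, h5, h6, h7, h8, h9⟩ := hm.2.2.2.2 i hiK h1 (by omega) h3 h4
  refine ⟨i, j', hm.upward hiK h1 (by omega) h3 h4, h1, h2,
    hm.upward hj'K (by omega) h6 h7 h8, ?_, h9⟩
  by_contra hb
  have : j' ≤ i := s.le_max' j' (by simp [s]; exact ⟨hj'K, by omega, by omega, h7, h8⟩)
  omega

lemma Chain.next {k l m j : ℕ} (hm : S.Chain k l m) (hj : j ∈ S.K) (hjk : j < k)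
    (h : j < m → S.T m ≤ S.T j + 4 * S.ρ l) :
    ∃ c, S.Chain k l c ∧ j < c ∧ S.T c ≤ S.T j + 4 * S.ρ l := by
  by_cases hjm : j < m
  · exact ⟨m, hm, hjm, h hjm⟩
  · obtain ⟨i, j', hi, -, hib, hj', hbj, hT⟩ := hm.exists_last (not_lt.1 hjm) hjk
    have := S.T_mono i hi.1 j hj hib
    exact ⟨j', hj', hbj, by omega⟩

/-- A copy that is active at the first chain element is kept alive by the chain, so that it cannot
be in the range which is empty for an expensive request. -/
lemma Chain.persist {k l j p c : ℕ} (hk : S.exp k l) (ha : S.T j + 4 * S.ρ l + 1 ≤ S.a (j + 1) l p)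
    (hc : S.Chain k l c) (hjc : j < c) (hT : S.T c ≤ S.T j + 4 * S.ρ l)
    (h1 : p + 2 * S.ρ l ≤ S.X k) (h2 : S.X k ≤ p + 8 * S.ρ l) : False := by
  have key : ∀ c', S.Chain k l c' → c ≤ c' → S.T c' < S.a c' l p := by
    intro c'
    induction c' using Nat.strong_induction_on with
    | _ c' ih =>
      intro hc' hcc'
      rcases hcc'.eq_or_lt with rfl | hlt
      · have := S.a_mono (j + 1) c hjc l p
        omega
      · have hc'k := hc'.2.1
        obtain ⟨i, j', hi, hci, hib, hj', hbj, hT'⟩ :=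
          hc.exists_last (b := c' - 1) (by omega) (by omega)
        have h3 := ih i (by omega) hi hci
        have h4 := S.refresh i hi.1 l p h3 (by have := hi.2.2.1; omega)
          (by have := hi.2.2.2.1; unfold ρ at *; omega)
        have h5 := S.a_mono (i + 1) c' (by omega) l p
        have h6 := S.T_mono c' hc'.1 j' hj'.1 (by omega)
        unfold ρ at *; omega
  exact S.exp_none k l p hk (key k (chain_self (S.exp_mem k l hk)) hc.2.1) h1 h2

/-- No request lies shortly to the left of an expensive one during the time of its chain. -/
lemma Chain.no_left {k l m j : ℕ} (hk : S.exp k l) (hm : S.Chain k l m) (hj : j ∈ S.K) (hjk : j < k)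
    (h1 : S.X j < S.X k) (h2 : S.X k ≤ S.X j + 4 * S.ρ l)
    (h3 : j < m → S.T m ≤ S.T j + 4 * S.ρ l) : False := by
  obtain ⟨c, hc, hjc, hTc⟩ := hm.next hj hjk h3
  rcases S.near j hj l with h | ⟨p, hp, h4, h5⟩
  · have := S.exp_lt k l hk
    unfold ρ at *; omega
  · exact hc.persist hk hp hjc hTc (by unfold ρ at *; omega) (by unfold ρ at *; omega)

/-- The copies left by an expensive request prevent expensive requests of the same or a lower level
to its left, or close to it, shortly afterwards. -/
lemma Chain.no_after_fill {k₁ l₁ k₂ l₂ m : ℕ} (hk₁ : S.exp k₁ l₁) (hk₂ : S.exp k₂ l₂)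
    (hl : l₂ ≤ l₁) (hl' : l₁ ≤ l₂ + S.δ) (hlt : k₁ < k₂) (hm : S.Chain k₂ l₂ m)
    (hT : k₁ < m → S.T m ≤ S.T k₁ + 4 * S.ρ l₂)
    (h1 : S.X k₂ ≤ S.X k₁ + 5 * S.ρ l₂) (h2 : S.X k₁ ≤ S.X k₂ + 5 * S.ρ l₁) : False := by
  obtain ⟨c, hc, hjc, hTc⟩ := hm.next (S.exp_mem _ _ hk₁) hlt hT
  have hbig := S.exp_lt k₂ l₂ hk₂
  have hpos := S.ρ_pos l₂
  have hle : S.ρ l₂ ≤ S.ρ l₁ :=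
    Nat.pow_le_pow_right (by have := S.twelve_le; omega) hl
  by_cases hcase : S.X k₂ ≤ S.X k₁ + 2 * S.ρ l₂
  · -- The copies of `k₁` between two and three scales to the left of `k₂` survive until `k₂`.
    obtain ⟨h3, h4⟩ := grid_bounds (g := 2) hpos (by unfold ρ at *; omega : _ ≤ S.X k₂)
    set p := (S.X k₂ / S.ρ l₂ - 2) * S.ρ l₂
    have hp : S.ρ l₂ ∣ p := dvd_mul_left _ _
    have := S.fill k₁ l₁ l₂ p hk₁ hl hl' hp (by omega) (by unfold ρ at *; omega)
    exact hc.persist hk₂ this hjc hTc h3 (by omega)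
  · -- `k₁` is further to the left, so that a copy to the left of `k₁` has to be taken.
    obtain ⟨h3, h4⟩ := grid_bounds (g := 5) hpos (by unfold ρ at *; omega : _ ≤ S.X k₂)
    set p := (S.X k₂ / S.ρ l₂ - 5) * S.ρ l₂
    have hp : S.ρ l₂ ∣ p := dvd_mul_left _ _
    have := S.fill k₁ l₁ l₂ p hk₁ hl hl' hp (by omega) (by unfold ρ at *; omega)
    exact hc.persist hk₂ this hjc hTc (by omega) (by omega)

/-- The chain element `z` that represents the threshold `X k + η` of the expensive request `k`: the
element where position plus time is smallest, among those from the first one on that is not to the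
right of the threshold. Only the properties that are used of this choice are recorded. -/
def IsRep (S : Trace) (k l η z : ℕ) : Prop :=
  S.Chain k l z ∧ S.X z ≤ S.X k + η ∧
  (∀ c, S.Chain k l c → c < z → S.X z < S.X c) ∧
  (∀ c, S.Chain k l c → z ≤ c → S.X z + S.T z ≤ S.X c + S.T c) ∧
  (∀ c, S.Chain k l c → c < z → S.X c ≤ S.X k + η → S.T z ≤ S.T c + S.ρ l)

/-- Both conditions on a representative follow from the minimality of position plus time; at a tie
the positions and times agree, and the requests are distinct. -/
lemma exists_isRep {k l : ℕ} (hk : k ∈ S.K) (η : ℕ) : ∃ z, S.IsRep k l η z := by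
  classical
  have hex : ∃ c, S.Chain k l c ∧ S.X c ≤ S.X k + η := ⟨k, chain_self hk, by omega⟩
  let f := Nat.find hex
  obtain ⟨hf, hfX⟩ : S.Chain k l f ∧ S.X f ≤ S.X k + η := Nat.find_spec hex
  have hmin : ∀ c, c < f → S.Chain k l c → S.X k + η < S.X c := fun c hc h => by
    by_contra hx
    exact Nat.find_min hex hc ⟨h, by omega⟩
  obtain ⟨z, hz, hzmin⟩ := Finset.exists_min_image
    (S.K.filter fun c => f ≤ c ∧ S.Chain k l c) (fun c => S.X c + S.T c)
    ⟨f, by simp [hf, hf.1]⟩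
  simp only [Finset.mem_filter, and_imp] at hz hzmin
  obtain ⟨hzK, hfz, hzc⟩ := hz
  have hT := S.T_mono f hf.1 z hzK hfz
  have hφ := hzmin f hf.1 le_rfl hf
  refine ⟨z, hzc, by omega, fun c hc hcz => ?_, fun c hc hzc' => hzmin c hc.1 (by omega) hc,
    fun c hc hcz hcX => ?_⟩
  · by_cases hcf : c < f
    · have := hmin c hcf hc; omega
    · have h1 := hzmin c hc.1 (by omega) hc
      have h2 := S.T_mono c hc.1 z hzK hcz.le
      have h3 : ¬ (S.X c = S.X z ∧ S.T c = S.T z) := fun h => by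
        have := S.inj c hc.1 z hzK h.1 h.2; omega
      omega
  · have hcf : f ≤ c := by
      by_contra hcf
      have := hmin c (by omega) hc; omega
    have h1 := S.T_mono f hf.1 c hc.1 hcf
    have h2 := hzc.2.2.1
    have h3 := hf.2.2.2.1
    omega

/-- The point `(hx, ht)` is on the middle piece of a path to request `z`: its distance from `z` is
between two and four scales. -/
def OnPiece (S : Trace) (l z hx ht : ℕ) : Prop :=
  hx ≤ S.X z ∧ ht ≤ S.T z ∧ 2 * S.ρ l ≤ (S.X z - hx) + (S.T z - ht) ∧
    (S.X z - hx) + (S.T z - ht) < 4 * S.ρ l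

/-- Pieces of different expensive requests of the same level are disjoint. -/
lemma OnPiece.same_level {k₁ k₂ l z₁ z₂ hx ht : ℕ} (hk₁ : S.exp k₁ l) (hk₂ : S.exp k₂ l)
    (hlt : k₁ < k₂) (hz₁ : S.Chain k₁ l z₁) (hz₂ : S.Chain k₂ l z₂)
    (h₁ : S.OnPiece l z₁ hx ht) (h₂ : S.OnPiece l z₂ hx ht) : False := by
  obtain ⟨a1, a2, a3, a4⟩ := h₁
  obtain ⟨b1, b2, b3, b4⟩ := h₂
  have c1 := hz₁.2.2.1
  have c2 := hz₁.2.2.2.1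
  have d1 := hz₂.2.2.1
  have d2 := hz₂.2.2.2.1
  have := S.T_mono z₁ hz₁.1 k₁ (S.exp_mem _ _ hk₁) hz₁.2.1
  exact hz₂.no_after_fill hk₁ hk₂ le_rfl (by omega) hlt (fun _ => by omega) (by omega) (by omega)

/-- If the piece of a representative meets a piece of lower level, then the end of the latter is
slightly to the right of the threshold. Hence this happens for a small share of the thresholds. -/
lemma OnPiece.clash {k₁ l₁ η z₁ k₂ l₂ z₂ hx ht : ℕ} (hk₁ : S.exp k₁ l₁) (hk₂ : S.exp k₂ l₂)
    (hl : l₂ < l₁) (hl' : l₁ ≤ l₂ + S.δ) (hη : η < S.ρ l₁) (hz₁ : S.IsRep k₁ l₁ η z₁)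
    (hz₂ : S.Chain k₂ l₂ z₂) (h₁ : S.OnPiece l₁ z₁ hx ht) (h₂ : S.OnPiece l₂ z₂ hx ht) :
    S.X k₁ + η < S.X z₂ ∧ S.X z₂ ≤ S.X k₁ + η + 4 * S.ρ l₂ := by
  obtain ⟨a1, a2, a3, a4⟩ := h₁
  obtain ⟨b1, b2, b3, b4⟩ := h₂
  obtain ⟨hc₁, r0, r1, r2, r3⟩ := hz₁
  have hρ := S.twelve_mul_le hl
  have c1 := hc₁.2.2.1
  have c2 := hc₁.2.2.2.1
  have hk₁K := S.exp_mem _ _ hk₁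
  have hk₂K := S.exp_mem _ _ hk₂
  rcases lt_or_ge z₂ z₁ with hlt | hge
  · -- The lower piece ends earlier. A position to the left of `k₁` contradicts `no_left`, and one
    -- between `k₁` and the threshold contradicts the choice of `z₁`, in the chain or not.
    have hle := hc₁.2.1
    by_cases hL : S.X z₂ < S.X k₁
    · exact (hc₁.no_left hk₁ hz₂.1 (by omega) hL (by omega) (fun _ => by omega)).elim
    by_cases hR : S.X k₁ + η < S.X z₂
    · omega
    by_cases hch : S.Chain k₁ l₁ z₂
    · have := r1 z₂ hch hlt
      have := r3 z₂ hch hlt (by omega)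
      omega
    · have := hc₁.lt_of_not hz₂.1 hlt (by omega) (by omega) hch
      omega
  · -- The lower piece ends later, hence to the left of `z₁`, as it is too short otherwise. If `z₂`
    -- is not after `k₁`, this contradicts `no_left` or the choice of `z₁`. If it is after `k₁`,
    -- this contradicts the choice of `z₁`, or the copies set up by `k₁` exclude `k₂`.
    have hTz := S.T_mono z₁ hc₁.1 z₂ hz₂.1 hge
    by_cases hX : S.X z₁ ≤ S.X z₂
    · omega
    rcases le_or_gt z₂ k₁ with hzk | hzk
    · by_cases hL : S.X z₂ < S.X k₁
      · have : z₂ ≠ k₁ := fun h => by subst h; omega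
        exact (hc₁.no_left hk₁ hz₂.1 (by omega) hL (by omega) (fun _ => by omega)).elim
      · have := r2 z₂ (hc₁.upward hz₂.1 hge hzk (by omega) (by omega)) hge
        omega
    · have hq := r2 k₁ (chain_self hk₁K) hc₁.2.1
      have hTk := S.T_mono z₁ hc₁.1 k₁ hk₁K hc₁.2.1
      have hTk' := S.T_mono k₁ hk₁K z₂ hz₂.1 hzk.le
      by_cases hL : S.X z₂ < S.X k₁
      · have d1 := hz₂.2.2.1
        have d2 := hz₂.2.2.2.1
        have d3 := hz₂.2.1
        exact (hz₂.no_after_fill hk₁ hk₂ hl.le hl' (by omega) (fun _ => by omega)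
          (by omega) (by omega)).elim
      · omega

end Trace
end DMCD

/-! ### Counting edges of a feasible solution -/

namespace DMCD

/-- All the paths to the requests that a set `F` of edges contains, seen through the relative
positions `hx` and times `ht` of the heads of the edges: for each request and each distance `d`
smaller than the length of a path to it, some edge has its head at distance `d` from the request. -/
def Covers {α : Type*} (F : Finset α) (hx ht : α → ℕ) (x t : ℕ) : Prop :=
  ∀ d < x + t, ∃ e ∈ F, hx e ≤ x ∧ ht e ≤ t ∧ (x - hx e) + (t - ht e) = d

/-- A set of edges covering `(x, t)` contains `b - a` edges at distances from `a` to `b - 1`. -/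
lemma Covers.exists_piece {α : Type*} {F : Finset α} {hx ht : α → ℕ} {x t : ℕ}
    (h : Covers F hx ht x t) {a b : ℕ} (hb : b ≤ x + t) :
    ∃ E ⊆ F, E.card = b - a ∧ ∀ e ∈ E, hx e ≤ x ∧ ht e ≤ t ∧ a ≤ (x - hx e) + (t - ht e) ∧
      (x - hx e) + (t - ht e) < b := by
  classical
  have h' : ∀ d : Finset.Ico a b, ∃ e ∈ F, hx e ≤ x ∧ ht e ≤ t ∧ (x - hx e) + (t - ht e) = d :=
    fun d => h d (by have := Finset.mem_Ico.1 d.2; omega)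
  choose f hf1 hf2 hf3 hf4 using h'
  refine ⟨Finset.univ.image f, ?_, ?_, ?_⟩
  · intro e he
    obtain ⟨d, -, rfl⟩ := Finset.mem_image.1 he
    exact hf1 d
  · rw [Finset.card_image_of_injective]
    · simp
    · intro d d' hd
      apply Subtype.ext
      rw [← hf4 d, ← hf4 d', hd]
  · intro e he
    obtain ⟨d, -, rfl⟩ := Finset.mem_image.1 he
    have := Finset.mem_Ico.1 d.2
    refine ⟨hf2 d, hf3 d, ?_, ?_⟩ <;> rw [hf4 d] <;> omega

/-- The number of space-time cells of side `r` that contain requests is at most `4 |F| / r`: the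
last `r` edges of a path to a request stay in the cell of the request and the three cells to the
left and below it. -/
lemma card_cells_mul_le {α : Type*} {F : Finset α} {hx ht : α → ℕ} {K : Finset ℕ} {X T : ℕ → ℕ}
    {r : ℕ} (hr : 0 < r) (hK : ∀ k ∈ K, r ≤ X k) (hF : ∀ k ∈ K, Covers F hx ht (X k) (T k))
    (hinj : Set.InjOn (fun k => (X k / r, T k / r)) K) : K.card * r ≤ 4 * F.card := by
  classical
  have h' : ∀ k : K, ∃ E ⊆ F, E.card = r - 0 ∧ ∀ e ∈ E, hx e ≤ X k ∧ ht e ≤ T k ∧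
      0 ≤ (X k - hx e) + (T k - ht e) ∧ (X k - hx e) + (T k - ht e) < r :=
    fun k => (hF k k.2).exists_piece (by have := hK k k.2; omega)
  choose E hE1 hE2 hE3 using h'
  calc K.card * r = ∑ k : K, (E k).card := by simp [hE2]
    _ = ∑ k : K, ∑ e ∈ F, if e ∈ E k then 1 else 0 := by
        refine Finset.sum_congr rfl fun k _ => ?_
        rw [← Finset.sum_filter, Finset.card_eq_sum_ones]
        refine Finset.sum_congr ?_ fun _ _ => rfl
        ext e; simpa using fun h => hE1 k h
    _ = ∑ e ∈ F, ∑ k : K, if e ∈ E k then 1 else 0 := Finset.sum_comm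
    _ ≤ ∑ e ∈ F, 4 := by
        refine Finset.sum_le_sum fun e _ => ?_
        rw [← Finset.sum_filter, ← Finset.card_eq_sum_ones]
        have hsub : ((Finset.univ.filter fun k : K => e ∈ E k).image
            fun k : K => (X k / r, T k / r)) ⊆
            ({hx e / r, hx e / r + 1} : Finset ℕ) ×ˢ ({ht e / r, ht e / r + 1} : Finset ℕ) := by
          intro y hy
          obtain ⟨k, hk, rfl⟩ := Finset.mem_image.1 hy
          obtain ⟨h1, h2, -, h4⟩ := hE3 k e (Finset.mem_filter.1 hk).2
          have a1 := Nat.div_le_div_right (c := r) h1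
          have a2 := Nat.div_le_div_right (c := r) h2
          have a3 : X k / r ≤ (hx e + r) / r := Nat.div_le_div_right (by omega)
          have a4 : T k / r ≤ (ht e + r) / r := Nat.div_le_div_right (by omega)
          rw [Nat.add_div_right _ hr] at a3 a4
          simp only [Finset.mem_product, Finset.mem_insert, Finset.mem_singleton]
          omega
        rw [← Finset.card_image_of_injOn (f := fun k : K => (X k / r, T k / r))]
        · refine (Finset.card_le_card hsub).trans ?_
          rw [Finset.card_product]
          exact Nat.mul_le_mul Finset.card_le_two Finset.card_le_two
        · intro k _ k' _ h
          exact Subtype.ext (hinj k.2 k'.2 h)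
    _ = 4 * F.card := by simp [mul_comm]

open Classical in
/-- The expensive requests of the levels `l₀, …, l₀ + δ - 1` have total scale at most `5 / 2 |F|`.
Each gives the weight `1 / ρ` to the piece of each of its `ρ` representatives. An edge receives at
most `1` in the lowest level whose pieces contain it, and at most `4 / δ` in each other level. -/
lemma Trace.sum_exp_le (S : Trace) {α : Type*} {F : Finset α} {hx ht : α → ℕ}
    (hF : ∀ k ∈ S.K, Covers F hx ht (S.X k) (S.T k)) (l₀ : ℕ) :
    ∑ q ∈ (S.K ×ˢ Finset.Ico l₀ (l₀ + S.δ)).filter (fun q => S.exp q.1 q.2), 2 * S.ρ q.2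
      ≤ 5 * F.card := by
  set Q := (S.K ×ˢ Finset.Ico l₀ (l₀ + S.δ)).filter (fun q => S.exp q.1 q.2) with hQ
  have hQmem : ∀ q ∈ Q, q.1 ∈ S.K ∧ l₀ ≤ q.2 ∧ q.2 < l₀ + S.δ ∧ S.exp q.1 q.2 := by
    intro q hq
    simpa [hQ, and_assoc] using hq
  choose! z hz using fun (q : ℕ × ℕ) (hq : q ∈ Q) (η : ℕ) =>
    Trace.exists_isRep (S := S) (l := q.2) (hQmem q hq).1 η
  have hpiece : ∀ q ∈ Q, ∀ η, ∃ E ⊆ F, E.card = 2 * S.ρ q.2 ∧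
      ∀ e ∈ E, S.OnPiece q.2 (z q η) (hx e) (ht e) := by
    intro q hq η
    have hc := (hz q hq η).1
    have h1 := S.exp_lt _ _ (hQmem q hq).2.2.2
    have h2 := hc.2.2.1
    obtain ⟨E, hE, hc, hm⟩ := (hF _ hc.1).exists_piece (a := 2 * S.ρ q.2) (b := 4 * S.ρ q.2)
      (by unfold Trace.ρ; omega)
    exact ⟨E, hE, by omega, fun e he => hm e he⟩
  choose! E hEF hEc hEm using hpiece
  have hδ : (0 : ℚ) < S.δ := by have := S.twelve_le; exact_mod_cast (by omega : 0 < S.δ)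
  have hρ : ∀ l, (0 : ℚ) < S.ρ l := fun l => by exact_mod_cast S.ρ_pos l
  -- the share of the thresholds of `q` whose piece contains `e`
  let w : ℕ × ℕ → α → ℚ := fun q e =>
    (((Finset.range (S.ρ q.2)).filter fun η => e ∈ E q η).card : ℚ) / S.ρ q.2
  have hw1 : ∀ q e, w q e ≤ 1 := by
    intro q e
    rw [div_le_one (hρ _)]
    exact_mod_cast (Finset.card_filter_le _ _).trans (by simp)
  have hsum : ∀ q ∈ Q, ∑ e ∈ F, w q e = 2 * S.ρ q.2 := by
    intro q hq
    have h1 : ∑ e ∈ F, ((Finset.range (S.ρ q.2)).filter fun η => e ∈ E q η).card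
        = S.ρ q.2 * (2 * S.ρ q.2) := by
      simp_rw [Finset.card_filter]
      rw [Finset.sum_comm]
      have : ∀ η ∈ Finset.range (S.ρ q.2),
          (∑ e ∈ F, if e ∈ E q η then 1 else 0) = 2 * S.ρ q.2 := by
        intro η _
        rw [← Finset.card_filter, ← hEc q hq η]
        congr 1
        ext e; simpa using fun h => hEF q hq η h
      rw [Finset.sum_congr rfl this]; simp
    rw [← Finset.sum_div, div_eq_iff (hρ _).ne']
    exact_mod_cast h1.trans (by ring)
  have hedge : ∀ e ∈ F, ∑ q ∈ Q, w q e ≤ 5 := by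
    intro e _
    set P := Q.filter fun q => ∃ η, e ∈ E q η with hP
    have hPsum : ∑ q ∈ Q, w q e = ∑ q ∈ P, w q e := by
      symm
      apply Finset.sum_subset (Finset.filter_subset _ _)
      intro q hq hn
      have : (Finset.range (S.ρ q.2)).filter (fun η => e ∈ E q η) = ∅ := by
        rw [Finset.filter_eq_empty_iff]
        intro η _ he
        exact hn (Finset.mem_filter.2 ⟨hq, η, he⟩)
      simp [w, this]
    rw [hPsum]
    have hlev : Set.InjOn (fun q : ℕ × ℕ => q.2) P := by
      intro q hq q' hq' (h : q.2 = q'.2)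
      obtain ⟨hqQ, η, he⟩ := Finset.mem_filter.1 (Finset.mem_coe.1 hq)
      obtain ⟨hqQ', η', he'⟩ := Finset.mem_filter.1 (Finset.mem_coe.1 hq')
      have p1 := hEm q hqQ η e he
      have p2 := hEm q' hqQ' η' e he'
      have x1 := (hQmem q hqQ).2.2.2
      have x2 := (hQmem q' hqQ').2.2.2
      have c1 := (hz q hqQ η).1
      have c2 := (hz q' hqQ' η').1
      rw [← h] at p2 x2 c2
      rcases lt_trichotomy q.1 q'.1 with hlt | heq | hlt
      · exact (Trace.OnPiece.same_level x1 x2 hlt c1 c2 p1 p2).elim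
      · exact Prod.ext heq h
      · exact (Trace.OnPiece.same_level x2 x1 hlt c2 c1 p2 p1).elim
    rcases P.eq_empty_or_nonempty with hPe | hPn
    · simp [hPe]
    obtain ⟨q₂, hq₂, hmin⟩ := Finset.exists_min_image P (fun q => q.2) hPn
    obtain ⟨hq₂Q, η₂, he₂⟩ := Finset.mem_filter.1 hq₂
    have hcardP : P.card ≤ S.δ := by
      have hsub : P.image (fun q => q.2) ⊆ Finset.Ico l₀ (l₀ + S.δ) := by
        intro l hl
        obtain ⟨q, hq, rfl⟩ := Finset.mem_image.1 hl
        have := hQmem q (Finset.mem_filter.1 hq).1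
        exact Finset.mem_Ico.2 ⟨this.2.1, this.2.2.1⟩
      have := Finset.card_le_card hsub
      rw [Finset.card_image_of_injOn hlev] at this
      simpa using this
    have hother : ∀ q ∈ P.erase q₂, w q e ≤ 4 / S.δ := by
      intro q hq
      obtain ⟨hne, hqP⟩ := Finset.mem_erase.1 hq
      obtain ⟨hqQ, -⟩ := Finset.mem_filter.1 hqP
      have hlt : q₂.2 < q.2 := lt_of_le_of_ne (hmin q hqP) fun h => hne (hlev hqP hq₂ h.symm)
      have w1 := hQmem q hqQ
      have w2 := hQmem q₂ hq₂Q
      have hcl : (Finset.range (S.ρ q.2)).filter (fun η => e ∈ E q η) ⊆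
          Finset.Ico (S.X (z q₂ η₂) - 4 * S.ρ q₂.2 - S.X q.1) (S.X (z q₂ η₂) - S.X q.1) := by
        intro η hη
        obtain ⟨hη, he⟩ := Finset.mem_filter.1 hη
        have := Trace.OnPiece.clash w1.2.2.2 w2.2.2.2 hlt (by omega) (Finset.mem_range.1 hη)
          (hz q hqQ η) (hz q₂ hq₂Q η₂).1 (hEm q hqQ η e he) (hEm q₂ hq₂Q η₂ e he₂)
        rw [Finset.mem_Ico]; omega
      have hcard : ((Finset.range (S.ρ q.2)).filter (fun η => e ∈ E q η)).card
          ≤ 4 * S.ρ q₂.2 := by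
        refine (Finset.card_le_card hcl).trans ?_
        rw [Nat.card_Ico]; omega
      have hmul := S.ρ_mul_le hlt
      rw [div_le_div_iff₀ (hρ _) hδ]
      have : ((Finset.range (S.ρ q.2)).filter (fun η => e ∈ E q η)).card * S.δ
          ≤ 4 * S.ρ q.2 := by nlinarith
      exact_mod_cast this
    rw [← Finset.add_sum_erase P _ hq₂]
    have h4 : ∑ q ∈ P.erase q₂, w q e ≤ 4 := by
      calc ∑ q ∈ P.erase q₂, w q e ≤ ∑ q ∈ P.erase q₂, 4 / (S.δ : ℚ) := Finset.sum_le_sum hother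
        _ = (P.erase q₂).card * (4 / (S.δ : ℚ)) := by simp
        _ ≤ S.δ * (4 / (S.δ : ℚ)) := by
            gcongr
            exact (Finset.card_erase_le).trans hcardP
        _ = 4 := by field_simp
    linarith [hw1 q₂ e]
  have hfin : ((∑ q ∈ Q, 2 * S.ρ q.2 : ℕ) : ℚ) ≤ ((5 * F.card : ℕ) : ℚ) := by
    push_cast
    calc ∑ q ∈ Q, 2 * (S.ρ q.2 : ℚ) = ∑ q ∈ Q, ∑ e ∈ F, w q e :=
          Finset.sum_congr rfl fun q hq => (hsum q hq).symm
      _ = ∑ e ∈ F, ∑ q ∈ Q, w q e := Finset.sum_comm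
      _ ≤ ∑ e ∈ F, 5 := Finset.sum_le_sum hedge
      _ = 5 * F.card := by simp [mul_comm]
  exact_mod_cast hfin

end DMCD

/-! ### The decision taken at a request -/

namespace DMCD

/-- A node `p` that holds a copy and serves a request at `x` within `c` scales of level `i`: the
origin, or an active position of level `i` at least two scales to the left of `x`. -/
def Cand (d : ℕ) (a : ℕ → ℕ → ℕ) (t x c i p : ℕ) : Prop :=
  (p = 0 ∧ x ≤ c * d ^ i) ∨ (t < a i p ∧ p + 2 * d ^ i ≤ x ∧ x ≤ p + c * d ^ i)

/-- Level `i` has a copy at distance between two and four scales to the left of `x`. -/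
def Good (d : ℕ) (a : ℕ → ℕ → ℕ) (t x i : ℕ) : Prop := ∃ p, Cand d a t x 4 i p

/-- Level `i` has a copy at distance between two and eight scales to the left of `x`. -/
def Fair (d : ℕ) (a : ℕ → ℕ → ℕ) (t x i : ℕ) : Prop := ∃ p, Cand d a t x 8 i p

/-- The least level from which on all levels are good. -/
noncomputable def goodFrom (d : ℕ) (a : ℕ → ℕ → ℕ) (t x : ℕ) : ℕ :=
  sInf {j | ∀ i, j ≤ i → Good d a t x i}

open Classical in
/-- Some node as in `Cand`, and the origin if there is none. -/
noncomputable def pick (d : ℕ) (a : ℕ → ℕ → ℕ) (t x c i : ℕ) : ℕ :=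
  if h : ∃ p, Cand d a t x c i p then h.choose else 0

open Classical in
/-- The position from which a request at `x` is served. If level `l` is the last one that is not
good, then it is a copy of level `l` if that level is fair, and a copy of level `l + 1` if not. -/
noncomputable def source (d : ℕ) (a : ℕ → ℕ → ℕ) (t x : ℕ) : ℕ :=
  match goodFrom d a t x with
  | 0 => pick d a t x 4 0
  | l + 1 => if Fair d a t x l then pick d a t x 8 l else pick d a t x 4 (l + 1)

/-- The request is expensive at level `l`: this is the last level that is not good, and it is not
even fair. -/
def Expensive (d : ℕ) (a : ℕ → ℕ → ℕ) (t x l : ℕ) : Prop :=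
  goodFrom d a t x = l + 1 ∧ ¬ Fair d a t x l

/-- The request at `x` activates position `p` of level `i`, for one of three reasons: `p` is active
and near `x`; level `i` is below a level that is not good, and `p` is a grid point near `x`; the
request is expensive at a level `l`, at most `d` levels above `i`, and `p` is a grid point within
eight scales of level `l`. -/
def Activates (d : ℕ) (a : ℕ → ℕ → ℕ) (t x i p : ℕ) : Prop :=
  (t < a i p ∧ p ≤ x ∧ x ≤ p + 9 * d ^ i) ∨
  (i < goodFrom d a t x ∧ d ^ i ∣ p ∧ source d a t x ≤ p ∧ p ≤ x ∧ x ≤ p + 4 * d ^ i) ∨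
  ∃ l, Expensive d a t x l ∧ i ≤ l ∧ l ≤ i + d ∧ d ^ i ∣ p ∧ p ≤ x ∧ x ≤ p + 8 * d ^ l

open Classical in
/-- The activity after a request: activated positions stay active for four scales of time. -/
noncomputable def update (d : ℕ) (a : ℕ → ℕ → ℕ) (t x i p : ℕ) : ℕ :=
  if Activates d a t x i p then max (a i p) (t + 4 * d ^ i + 1) else a i p

variable {d : ℕ} {a : ℕ → ℕ → ℕ} {t x : ℕ}

lemma le_update (i p : ℕ) : a i p ≤ update d a t x i p := by
  unfold update; split_ifs
  · exact le_max_left _ _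
  · exact le_rfl

lemma Activates.le_update {i p : ℕ} (h : Activates d a t x i p) :
    t + 4 * d ^ i + 1 ≤ update d a t x i p := by
  unfold update; rw [if_pos h]; exact le_max_right _ _

lemma good_of_goodFrom_le (hd : 2 ≤ d) {i : ℕ} (h : goodFrom d a t x ≤ i) : Good d a t x i := by
  have hne : {j | ∀ i, j ≤ i → Good d a t x i}.Nonempty := by
    refine ⟨x, fun i hi => ⟨0, Or.inl ⟨rfl, ?_⟩⟩⟩
    have : i < d ^ i := Nat.lt_pow_self (by omega)
    omega
  exact Nat.sInf_mem hne i h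

lemma not_good_of_goodFrom (hd : 2 ≤ d) {l : ℕ} (h : goodFrom d a t x = l + 1) :
    ¬ Good d a t x l := by
  intro hg
  have : goodFrom d a t x ≤ l := Nat.sInf_le fun i hi => by
    rcases hi.eq_or_lt with rfl | hlt
    · exact hg
    · exact good_of_goodFrom_le hd (by omega)
  omega

lemma lt_of_not_good {i : ℕ} (h : ¬ Good d a t x i) : 4 * d ^ i < x := by
  by_contra hx
  exact h ⟨0, Or.inl ⟨rfl, by omega⟩⟩

lemma lt_of_not_fair {i : ℕ} (h : ¬ Fair d a t x i) : 8 * d ^ i < x := by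
  by_contra hx
  exact h ⟨0, Or.inl ⟨rfl, by omega⟩⟩

lemma lt_of_lt_goodFrom (hd : 2 ≤ d) {i : ℕ} (h : i < goodFrom d a t x) : 4 * d ^ i < x := by
  obtain ⟨l, hl⟩ := Nat.exists_eq_succ_of_ne_zero (by omega : goodFrom d a t x ≠ 0)
  have h1 := lt_of_not_good (not_good_of_goodFrom hd hl)
  have : d ^ i ≤ d ^ l := Nat.pow_le_pow_right (by omega) (by omega)
  omega

lemma cand_pick {c i : ℕ} (h : ∃ p, Cand d a t x c i p) : Cand d a t x c i (pick d a t x c i) := by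
  unfold pick; rw [dif_pos h]; exact h.choose_spec

lemma source_zero (hd : 2 ≤ d) (h : goodFrom d a t x = 0) :
    Cand d a t x 4 0 (source d a t x) := by
  unfold source; rw [h]; exact cand_pick (good_of_goodFrom_le hd (by omega))

lemma source_fair {l : ℕ} (h : goodFrom d a t x = l + 1) (hf : Fair d a t x l) :
    Cand d a t x 8 l (source d a t x) := by
  unfold source; rw [h]; simp only [if_pos hf]; exact cand_pick hf

lemma source_expensive (hd : 2 ≤ d) {l : ℕ} (h : Expensive d a t x l) :
    Cand d a t x 4 (l + 1) (source d a t x) := by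
  unfold source; rw [h.1]; simp only [if_neg h.2]
  exact cand_pick (good_of_goodFrom_le hd h.1.le)

lemma exists_cand_source (hd : 2 ≤ d) : ∃ c i, Cand d a t x c i (source d a t x) := by
  rcases h : goodFrom d a t x with _ | l
  · exact ⟨_, _, source_zero hd h⟩
  · by_cases hf : Fair d a t x l
    · exact ⟨_, _, source_fair h hf⟩
    · exact ⟨_, _, source_expensive hd ⟨h, hf⟩⟩

lemma Cand.le {c i p : ℕ} (h : Cand d a t x c i p) : p ≤ x := by
  rcases h with ⟨rfl, -⟩ | ⟨-, h, -⟩ <;> omega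

lemma Cand.sub_le {c i p : ℕ} (h : Cand d a t x c i p) : x - p ≤ c * d ^ i := by
  rcases h with ⟨rfl, h⟩ | ⟨-, -, h⟩ <;> omega

lemma source_le (hd : 2 ≤ d) : source d a t x ≤ x := by
  obtain ⟨c, i, h⟩ := exists_cand_source (a := a) (t := t) (x := x) hd
  exact h.le

lemma source_eq_zero_or (hd : 2 ≤ d) :
    source d a t x = 0 ∨ ∃ i, t < a i (source d a t x) := by
  obtain ⟨c, i, ⟨h, -⟩ | ⟨h, -⟩⟩ := exists_cand_source (a := a) (t := t) (x := x) hd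
  · exact Or.inl h
  · exact Or.inr ⟨i, h⟩

lemma Expensive.source_le (hd : 4 ≤ d) {l : ℕ} (h : Expensive d a t x l) :
    source d a t x = 0 ∨ source d a t x + 8 * d ^ l ≤ x := by
  rcases source_expensive (by omega) h with ⟨h0, -⟩ | ⟨-, h1, -⟩
  · exact Or.inl h0
  · right
    have : 4 * d ^ l ≤ d ^ (l + 1) := by rw [pow_succ, mul_comm]; gcongr
    omega

lemma Fair.source_le (hd : 2 ≤ d) {l : ℕ} (h : goodFrom d a t x = l + 1) (hf : Fair d a t x l) :
    source d a t x = 0 ∨ source d a t x + 4 * d ^ l ≤ x := by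
  rcases source_fair h hf with ⟨h0, -⟩ | ⟨h1, h2, h3⟩
  · exact Or.inl h0
  · right
    by_contra hx
    exact not_good_of_goodFrom hd h ⟨_, Or.inr ⟨h1, h2, by omega⟩⟩

lemma source_le_of_lt (hd : 4 ≤ d) {i : ℕ} (hi : i < goodFrom d a t x) :
    source d a t x = 0 ∨ source d a t x + 4 * d ^ i ≤ x := by
  obtain ⟨l, hl⟩ := Nat.exists_eq_succ_of_ne_zero (by omega : goodFrom d a t x ≠ 0)
  have hp : d ^ i ≤ d ^ l := Nat.pow_le_pow_right (by omega) (by omega)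
  by_cases hf : Fair d a t x l
  · rcases Fair.source_le (by omega) hl hf with h | h
    · exact Or.inl h
    · right; omega
  · rcases Expensive.source_le hd ⟨hl, hf⟩ with h | h
    · exact Or.inl h
    · right; omega

/-- Activated positions hold a copy: they were active, or lie on the path to the request. -/
lemma Activates.le (hd : 4 ≤ d) {i p : ℕ} (h : Activates d a t x i p) :
    p ≤ x ∧ (t < a i p ∨ source d a t x ≤ p) := by
  rcases h with ⟨h1, h2, -⟩ | ⟨-, -, h1, h2, -⟩ | ⟨l, h1, -, -, -, h2, h3⟩
  · exact ⟨h2, Or.inl h1⟩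
  · exact ⟨h2, Or.inr h1⟩
  · refine ⟨h2, Or.inr ?_⟩
    rcases h1.source_le hd with h | h <;> omega

lemma activates_grid (hd : 4 ≤ d) {i : ℕ} (hi : i < goodFrom d a t x) :
    Activates d a t x i ((x / d ^ i - 2) * d ^ i) ∧
      (x / d ^ i - 2) * d ^ i + 2 * d ^ i ≤ x ∧ x < (x / d ^ i - 2) * d ^ i + 3 * d ^ i := by
  have hx := lt_of_lt_goodFrom (by omega) hi
  obtain ⟨h1, h2⟩ := grid_bounds (g := 2) (x := x) (pow_pos (by omega : 0 < d) i) (by omega)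
  have hs := source_le_of_lt hd hi
  exact ⟨Or.inr (Or.inl ⟨hi, dvd_mul_left _ _, by omega, by omega, by omega⟩), h1, h2⟩

/-- After a request every level is good at its position. -/
lemma good_update (hd : 4 ≤ d) (i : ℕ) : x ≤ 4 * d ^ i ∨ ∃ p,
    t + 4 * d ^ i + 1 ≤ update d a t x i p ∧ p + 2 * d ^ i ≤ x ∧ x ≤ p + 4 * d ^ i := by
  by_cases hi : i < goodFrom d a t x
  · obtain ⟨hA, h1, h2⟩ := activates_grid hd hi
    exact Or.inr ⟨_, hA.le_update, h1, by omega⟩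
  · obtain ⟨p, ⟨-, h⟩ | ⟨h1, h2, h3⟩⟩ := good_of_goodFrom_le (by omega) (not_lt.1 hi)
    · exact Or.inl h
    · exact Or.inr ⟨p, Activates.le_update (Or.inl ⟨h1, by omega, by omega⟩), h2, h3⟩

end DMCD

/-! ### The cost of one phase -/

namespace DMCD
namespace Trace

variable (S : Trace)

/-- The position `p` is kept at time `v` because of some request, as in `Activates`. -/
def Kept (p v : ℕ) : Prop :=
  ∃ i, (∃ k ∈ S.K, 4 * S.ρ i < S.X k) ∧ ∃ k ∈ S.K, S.T k ≤ v ∧ v ≤ S.T k + 4 * S.ρ i ∧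
    S.ρ i ∣ p ∧ p ≤ S.X k ∧
      (S.X k ≤ p + 9 * S.ρ i ∨ ∃ l, S.exp k l ∧ i ≤ l ∧ l ≤ i + S.δ ∧ S.X k ≤ p + 8 * S.ρ l)

/-- Only the levels `l₀, …, l₀ + δ - 1` matter for an optimal solution with `f` edges: at lower
levels each request may pay its scale, and higher levels are always good because of the origin. -/
structure Window (f l₀ : ℕ) : Prop where
  low : ∀ l < l₀, S.K.card * S.ρ l ≤ f
  high : ∀ k ∈ S.K, S.X k ≤ 4 * S.ρ (l₀ + S.δ)

variable {S} {f l₀ : ℕ}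

lemma Window.lt_of_lt (hW : S.Window f l₀) {k i : ℕ} (hk : k ∈ S.K) (h : 4 * S.ρ i < S.X k) :
    i < l₀ + S.δ := by
  by_contra hi
  have h1 := hW.high k hk
  have h2 : S.ρ (l₀ + S.δ) ≤ S.ρ i :=
    Nat.pow_le_pow_right (by have := S.twelve_le; omega) (not_lt.1 hi)
  omega

open Classical in
/-- If each request is related to at most one level, the scales of the related levels below `l₀` sum
to at most `f`, since each of them is at most `f / |K|`. -/
lemma Window.sum_low_le (hW : S.Window f l₀) (r : ℕ → ℕ → Prop)
    (hr : ∀ k l l', r k l → r k l' → l = l') :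
    ∑ q ∈ (S.K ×ˢ Finset.range l₀).filter (fun q => r q.1 q.2), S.ρ q.2 ≤ f := by
  set Q := (S.K ×ˢ Finset.range l₀).filter (fun q => r q.1 q.2) with hQ
  rcases S.K.eq_empty_or_nonempty with h | h
  · simp [hQ, h]
  have hc : Q.card ≤ S.K.card := by
    apply Finset.card_le_card_of_injOn (fun q => q.1)
    · intro q hq
      exact (Finset.mem_product.1 (Finset.mem_filter.1 (Finset.mem_coe.1 hq)).1).1
    · intro q hq q' hq' (h : q.1 = q'.1)
      have h1 := (Finset.mem_filter.1 (Finset.mem_coe.1 hq)).2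
      have h2 := (Finset.mem_filter.1 (Finset.mem_coe.1 hq')).2
      rw [← h] at h2
      exact Prod.ext h (hr _ _ _ h1 h2)
  refine Nat.le_of_mul_le_mul_left ?_ h.card_pos
  rw [Finset.mul_sum]
  calc ∑ q ∈ Q, S.K.card * S.ρ q.2 ≤ ∑ q ∈ Q, f := Finset.sum_le_sum fun q hq =>
        hW.low _ (Finset.mem_range.1 (Finset.mem_product.1 (Finset.mem_filter.1 hq).1).2)
    _ = Q.card * f := by simp
    _ ≤ S.K.card * f := Nat.mul_le_mul_right _ hc

lemma sum_split (r : ℕ → ℕ → Prop) [∀ k l, Decidable (r k l)] (l₀ : ℕ) :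
    ∑ q ∈ (S.K ×ˢ Finset.range (l₀ + S.δ)).filter (fun q => r q.1 q.2), S.ρ q.2
      = ∑ q ∈ (S.K ×ˢ Finset.range l₀).filter (fun q => r q.1 q.2), S.ρ q.2 +
        ∑ q ∈ (S.K ×ˢ Finset.Ico l₀ (l₀ + S.δ)).filter (fun q => r q.1 q.2), S.ρ q.2 := by
  rw [← Finset.sum_union]
  · congr 1
    ext q
    simp only [Finset.mem_filter, Finset.mem_product, Finset.mem_range, Finset.mem_Ico,
      Finset.mem_union]
    constructor
    · rintro ⟨⟨h1, h2⟩, h3⟩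
      by_cases h : q.2 < l₀
      · exact Or.inl ⟨⟨h1, h⟩, h3⟩
      · exact Or.inr ⟨⟨h1, by omega, h2⟩, h3⟩
    · rintro (⟨⟨h1, h2⟩, h3⟩ | ⟨⟨h1, -, h2⟩, h3⟩)
      · exact ⟨⟨h1, by omega⟩, h3⟩
      · exact ⟨⟨h1, h2⟩, h3⟩
  · rw [Finset.disjoint_left]
    intro q h1 h2
    simp only [Finset.mem_filter, Finset.mem_product, Finset.mem_range, Finset.mem_Ico] at h1 h2
    omega

variable {α : Type*} {F : Finset α} {hx ht : α → ℕ}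

open Classical in
/-- The total scale of all expensive requests. -/
lemma Window.sum_exp_le (hW : S.Window F.card l₀)
    (hF : ∀ k ∈ S.K, Covers F hx ht (S.X k) (S.T k)) :
    ∑ q ∈ (S.K ×ˢ Finset.range (l₀ + S.δ)).filter (fun q => S.exp q.1 q.2), S.ρ q.2
      ≤ 4 * F.card := by
  have h1 := S.sum_exp_le hF l₀
  rw [← Finset.mul_sum] at h1
  have h2 := hW.sum_low_le S.exp S.exp_unique
  rw [sum_split (r := S.exp)]
  omega

/-- The cells of side `ρ` that contain requests outside the leftmost column. -/
noncomputable def cells (S : Trace) (i : ℕ) : Finset (ℕ × ℕ) :=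
  (S.K.filter fun k => S.ρ i ≤ S.X k).image fun k => (S.X k / S.ρ i, S.T k / S.ρ i)

lemma card_cells_le (i : ℕ) : (S.cells i).card ≤ S.K.card :=
  Finset.card_image_le.trans (Finset.card_filter_le _ _)

lemma card_cells_mul (hF : ∀ k ∈ S.K, Covers F hx ht (S.X k) (S.T k)) (i : ℕ) :
    (S.cells i).card * S.ρ i ≤ 4 * F.card := by
  obtain ⟨u, hu, hinj, himg⟩ := Finset.exists_subset_injOn_image_eq_of_surjOn
    (f := fun k => (S.X k / S.ρ i, S.T k / S.ρ i)) (S.K.filter fun k => S.ρ i ≤ S.X k)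
    (S.cells i) (by unfold cells; rw [Finset.coe_image]; exact Set.surjOn_image _ _)
  rw [← himg, Finset.card_image_of_injOn hinj]
  exact card_cells_mul_le (S.ρ_pos i) (fun k hk => (Finset.mem_filter.1 (hu hk)).2)
    (fun k hk => hF k (Finset.mem_filter.1 (hu hk)).1) hinj

/-- The positions and times near requests, at level `i`. -/
noncomputable def nearSet (S : Trace) (i : ℕ) : Finset (ℕ × ℕ) :=
  (S.cells i).biUnion fun c => ((Finset.Icc (c.1 - 9) c.1).image fun m => m * S.ρ i) ×ˢ
    Finset.Ico (c.2 * S.ρ i) (c.2 * S.ρ i + 5 * S.ρ i)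

lemma card_nearSet_le (i : ℕ) : (S.nearSet i).card ≤ 50 * ((S.cells i).card * S.ρ i) := by
  refine (Finset.card_biUnion_le_card_mul _ _ (10 * (5 * S.ρ i)) fun c _ => ?_).trans
    (le_of_eq (by ring))
  rw [Finset.card_product]
  refine Nat.mul_le_mul (Finset.card_image_le.trans ?_) ?_
  · rw [Nat.card_Icc]; omega
  · rw [Nat.card_Ico]; omega

lemma mem_nearSet {i k p v : ℕ} (hk : k ∈ S.K) (hp : 0 < p) (hd : S.ρ i ∣ p) (hpx : p ≤ S.X k)
    (hxp : S.X k ≤ p + 9 * S.ρ i) (hv : S.T k ≤ v) (hv' : v ≤ S.T k + 4 * S.ρ i) :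
    (p, v) ∈ S.nearSet i := by
  have hpos := S.ρ_pos i
  obtain ⟨m, rfl⟩ := hd
  have hm : 0 < m := Nat.pos_of_ne_zero (by rintro rfl; simp at hp)
  have h1 : m ≤ S.X k / S.ρ i := by rw [Nat.le_div_iff_mul_le hpos, mul_comm]; exact hpx
  have h2 : S.X k / S.ρ i ≤ m + 9 := by
    rw [Nat.div_le_iff_le_mul_add_pred hpos]
    have : S.ρ i * (m + 9) = S.ρ i * m + 9 * S.ρ i := by ring
    omega
  have h3 := Nat.div_mul_le_self (S.T k) (S.ρ i)
  have h4 := Nat.lt_div_mul_add (a := S.T k) hpos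
  refine Finset.mem_biUnion.2 ⟨(S.X k / S.ρ i, S.T k / S.ρ i), ?_, ?_⟩
  · refine Finset.mem_image.2 ⟨k, Finset.mem_filter.2 ⟨hk, ?_⟩, rfl⟩
    nlinarith
  · simp only [Finset.mem_product, Finset.mem_image, Finset.mem_Icc, Finset.mem_Ico]
    exact ⟨⟨m, by omega, mul_comm _ _⟩, by omega, by omega⟩

/-- The positions and times of level `i` within the reach of an expensive request `k` of
level `l`. -/
noncomputable def fillSet (S : Trace) (k l i : ℕ) : Finset (ℕ × ℕ) :=
  ((Finset.Icc (S.X k / S.ρ i - 8 * S.ρ (l - i)) (S.X k / S.ρ i)).image fun m => m * S.ρ i) ×ˢ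
    Finset.Icc (S.T k) (S.T k + 4 * S.ρ i)

lemma card_fillSet_le (k : ℕ) {l i : ℕ} (hil : i ≤ l) :
    (S.fillSet k l i).card ≤ 45 * S.ρ l := by
  have h1 : S.ρ (l - i) * S.ρ i = S.ρ l := by
    unfold ρ; rw [← pow_add]; congr 1; omega
  have h2 := S.ρ_pos (l - i)
  have h3 := S.ρ_pos i
  unfold fillSet
  rw [Finset.card_product]
  calc _ ≤ (9 * S.ρ (l - i)) * (5 * S.ρ i) := by
        refine Nat.mul_le_mul (Finset.card_image_le.trans ?_) ?_
        · rw [Nat.card_Icc]; omega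
        · rw [Nat.card_Icc]; omega
    _ = 45 * S.ρ l := by rw [← h1]; ring

lemma mem_fillSet {i k l p v : ℕ} (hil : i ≤ l) (hd : S.ρ i ∣ p) (hpx : p ≤ S.X k)
    (hxp : S.X k ≤ p + 8 * S.ρ l) (hv : S.T k ≤ v) (hv' : v ≤ S.T k + 4 * S.ρ i) :
    (p, v) ∈ S.fillSet k l i := by
  have hpos := S.ρ_pos i
  have h0 : S.ρ (l - i) * S.ρ i = S.ρ l := by
    unfold ρ; rw [← pow_add]; congr 1; omega
  obtain ⟨m, rfl⟩ := hd
  have h1 : m ≤ S.X k / S.ρ i := by rw [Nat.le_div_iff_mul_le hpos, mul_comm]; exact hpx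
  have h2 : S.X k / S.ρ i ≤ m + 8 * S.ρ (l - i) := by
    rw [Nat.div_le_iff_le_mul_add_pred hpos]
    have : S.ρ i * (m + 8 * S.ρ (l - i)) = S.ρ i * m + 8 * (S.ρ (l - i) * S.ρ i) := by ring
    omega
  simp only [fillSet, Finset.mem_product, Finset.mem_image, Finset.mem_Icc]
  exact ⟨⟨m, by omega, mul_comm _ _⟩, hv, hv'⟩

lemma sum_range_ρ_le (m : ℕ) : ∑ i ∈ Finset.range m, S.ρ i ≤ S.ρ m :=
  (Nat.geomSum_lt (by have := S.twelve_le; omega) (fun _ h => Finset.mem_range.1 h)).le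

lemma Window.card_mul_sum_le (hW : S.Window f l₀) :
    S.K.card * ∑ i ∈ Finset.range l₀, S.ρ i ≤ 2 * f := by
  rcases l₀ with _ | m
  · simp
  · rw [Finset.sum_range_succ]
    have h1 := hW.low m (by omega)
    have h2 := S.sum_range_ρ_le m
    nlinarith

open Classical in
/-- The storage of a phase, apart from the origin. -/
lemma Window.exists_kept (hW : S.Window F.card l₀)
    (hF : ∀ k ∈ S.K, Covers F hx ht (S.X k) (S.T k)) :
    ∃ B : Finset (ℕ × ℕ), B.card ≤ 410 * S.δ * F.card ∧
      ∀ p v, 0 < p → S.Kept p v → (p, v) ∈ B := by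
  set Q := (S.K ×ˢ Finset.range (l₀ + S.δ)).filter (fun q => S.exp q.1 q.2) with hQ
  refine ⟨((Finset.range l₀).biUnion S.nearSet ∪ (Finset.Ico l₀ (l₀ + S.δ)).biUnion S.nearSet) ∪
    Q.biUnion fun q => (Finset.Icc (q.2 - S.δ) q.2).biUnion fun i => S.fillSet q.1 q.2 i, ?_, ?_⟩
  · have h1 : ((Finset.range l₀).biUnion S.nearSet).card ≤ 100 * F.card := by
      calc _ ≤ ∑ i ∈ Finset.range l₀, (S.nearSet i).card := Finset.card_biUnion_le
        _ ≤ ∑ i ∈ Finset.range l₀, 50 * (S.K.card * S.ρ i) := Finset.sum_le_sum fun i _ =>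
            (card_nearSet_le i).trans (by gcongr; exact card_cells_le i)
        _ = 50 * (S.K.card * ∑ i ∈ Finset.range l₀, S.ρ i) := by
            rw [Finset.mul_sum, Finset.mul_sum]
        _ ≤ _ := by have := hW.card_mul_sum_le; omega
    have h2 : ((Finset.Ico l₀ (l₀ + S.δ)).biUnion S.nearSet).card ≤ S.δ * (200 * F.card) := by
      refine (Finset.card_biUnion_le_card_mul _ _ (200 * F.card) fun i _ => ?_).trans (by simp)
      have := card_nearSet_le (S := S) i
      have := card_cells_mul hF i
      omega
    have h3 : (Q.biUnion fun q => (Finset.Icc (q.2 - S.δ) q.2).biUnion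
        fun i => S.fillSet q.1 q.2 i).card ≤ (S.δ + 1) * (180 * F.card) := by
      calc _ ≤ ∑ q ∈ Q, ((Finset.Icc (q.2 - S.δ) q.2).biUnion
              fun i => S.fillSet q.1 q.2 i).card := Finset.card_biUnion_le
        _ ≤ ∑ q ∈ Q, (S.δ + 1) * 45 * S.ρ q.2 := Finset.sum_le_sum fun q _ => by
            refine (Finset.card_biUnion_le_card_mul _ _ (45 * S.ρ q.2) fun i hi =>
              card_fillSet_le q.1 (Finset.mem_Icc.1 hi).2).trans ?_
            rw [Nat.card_Icc, mul_assoc]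
            exact Nat.mul_le_mul_right _ (by omega)
        _ = (S.δ + 1) * 45 * ∑ q ∈ Q, S.ρ q.2 := by rw [Finset.mul_sum]
        _ ≤ (S.δ + 1) * 45 * (4 * F.card) := Nat.mul_le_mul_left _ (hW.sum_exp_le hF)
        _ = _ := by ring
    have h4 := S.twelve_le
    refine (Finset.card_union_le _ _).trans ?_
    have h5 := Finset.card_union_le ((Finset.range l₀).biUnion S.nearSet)
      ((Finset.Ico l₀ (l₀ + S.δ)).biUnion S.nearSet)
    nlinarith
  · rintro p v hp ⟨i, ⟨k', hk', hlt⟩, k, hk, h1, h2, h3, h4, h5⟩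
    have hi := hW.lt_of_lt hk' hlt
    rcases h5 with h5 | ⟨l, h5, h6, h7, h8⟩
    · have := mem_nearSet hk hp h3 h4 h5 h1 h2
      apply Finset.mem_union_left
      by_cases hil : i < l₀
      · exact Finset.mem_union_left _ (Finset.mem_biUnion.2 ⟨i, by simpa using hil, this⟩)
      · exact Finset.mem_union_right _
          (Finset.mem_biUnion.2 ⟨i, Finset.mem_Ico.2 ⟨by omega, hi⟩, this⟩)
    · apply Finset.mem_union_right
      refine Finset.mem_biUnion.2 ⟨(k, l), ?_, Finset.mem_biUnion.2
        ⟨i, Finset.mem_Icc.2 ⟨by omega, h6⟩, mem_fillSet h6 h3 h4 h8 h1 h2⟩⟩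
      simp only [hQ, Finset.mem_filter, Finset.mem_product, Finset.mem_range]
      have := S.exp_lt k l h5
      exact ⟨⟨hk, hW.lt_of_lt hk (by unfold ρ; omega)⟩, h5⟩

open Classical in
/-- The horizontal edges of a phase, if request `k` pays `h k`, and `j k` is the least level from
which on all levels are good. -/
lemma Window.sum_horizontal_le (hW : S.Window F.card l₀)
    (hF : ∀ k ∈ S.K, Covers F hx ht (S.X k) (S.T k)) (h j : ℕ → ℕ)
    (hX : ∀ k ∈ S.K, h k ≤ S.X k) (h0 : ∀ k ∈ S.K, j k = 0 → h k ≤ 4)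
    (hj : ∀ k ∈ S.K, ∀ l, j k = l + 1 → 4 * S.ρ l < S.X k ∧
      (h k ≤ 8 * S.ρ l ∨ (S.exp k l ∧ h k ≤ 4 * S.δ * S.ρ l)))
    (hcell : ∀ k ∈ S.K, ∀ k' ∈ S.K, ∀ l, k < k' → j k = l + 1 → j k' = l + 1 →
      S.X k / S.ρ l = S.X k' / S.ρ l → S.T k / S.ρ l ≠ S.T k' / S.ρ l) :
    ∑ k ∈ S.K, h k ≤ 52 * S.δ * F.card := by
  set R := Finset.range (l₀ + S.δ) with hR
  have hpt : ∀ k ∈ S.K, h k ≤ (if 1 ≤ S.X k then 4 else 0) +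
      ∑ l ∈ R, (if j k = l + 1 then 8 * S.ρ l else 0) +
      ∑ l ∈ R, (if S.exp k l then 4 * S.δ * S.ρ l else 0) := by
    intro k hk
    rcases hjk : j k with _ | l
    · have := h0 k hk hjk
      have := hX k hk
      split_ifs <;> omega
    · obtain ⟨h1, h2⟩ := hj k hk l hjk
      have hl : l ∈ R := Finset.mem_range.2 (hW.lt_of_lt hk h1)
      rcases h2 with h2 | ⟨h2, h3⟩
      · have := Finset.single_le_sum (f := fun l' => if l + 1 = l' + 1 then 8 * S.ρ l' else 0)
          (fun _ _ => Nat.zero_le _) hl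
        simp only [if_true] at this
        omega
      · have := Finset.single_le_sum (f := fun l' => if S.exp k l' then 4 * S.δ * S.ρ l' else 0)
          (fun _ _ => Nat.zero_le _) hl
        simp only [if_pos h2] at this
        omega
  have hA : ∑ k ∈ S.K, (if 1 ≤ S.X k then 4 else 0) ≤ 16 * F.card := by
    rw [← Finset.sum_filter, Finset.sum_const, smul_eq_mul]
    have := card_cells_mul_le (F := F) (hx := hx) (ht := ht) (X := S.X) (T := S.T) (r := 1)
      (K := S.K.filter fun k => 1 ≤ S.X k) one_pos (fun k hk => (Finset.mem_filter.1 hk).2)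
      (fun k hk => hF k (Finset.mem_filter.1 hk).1) (by
        intro k hk k' hk' hkk
        simp only [Nat.div_one, Prod.mk.injEq] at hkk
        exact S.inj k (Finset.mem_filter.1 (Finset.mem_coe.1 hk)).1 k'
          (Finset.mem_filter.1 (Finset.mem_coe.1 hk')).1 hkk.1 hkk.2)
    omega
  have hswap : ∀ (r : ℕ → ℕ → Prop) [∀ k l, Decidable (r k l)] (c : ℕ),
      ∑ k ∈ S.K, ∑ l ∈ R, (if r k l then c * S.ρ l else 0)
        = c * ∑ q ∈ (S.K ×ˢ R).filter (fun q => r q.1 q.2), S.ρ q.2 := by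
    intro r _ c
    rw [Finset.mul_sum, Finset.sum_filter, Finset.sum_product]
  have hB : ∑ q ∈ (S.K ×ˢ R).filter (fun q => j q.1 = q.2 + 1), S.ρ q.2
      ≤ F.card + S.δ * (4 * F.card) := by
    rw [hR, sum_split (r := fun k l => j k = l + 1)]
    have h1 := hW.sum_low_le (fun k l => j k = l + 1) (fun k l l' h h' => by omega)
    have h2 : ∑ q ∈ (S.K ×ˢ Finset.Ico l₀ (l₀ + S.δ)).filter (fun q => j q.1 = q.2 + 1), S.ρ q.2
        ≤ S.δ * (4 * F.card) := by
      rw [Finset.sum_filter, Finset.sum_product_right]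
      refine (Finset.sum_le_card_nsmul _ _ (4 * F.card) fun l _ => ?_).trans (by simp)
      simp only
      rw [← Finset.sum_filter, Finset.sum_const, smul_eq_mul]
      refine card_cells_mul_le (S.ρ_pos l) (fun k hk => ?_)
        (fun k hk => hF k (Finset.mem_filter.1 hk).1) ?_
      · obtain ⟨hk, hjk⟩ := Finset.mem_filter.1 hk
        have := (hj k hk l hjk).1
        omega
      · intro k hk k' hk' hkk
        obtain ⟨hk, hjk⟩ := Finset.mem_filter.1 (Finset.mem_coe.1 hk)
        obtain ⟨hk', hjk'⟩ := Finset.mem_filter.1 (Finset.mem_coe.1 hk')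
        simp only [Prod.mk.injEq] at hkk
        rcases lt_trichotomy k k' with hlt | heq | hlt
        · exact (hcell k hk k' hk' l hlt hjk hjk' hkk.1 hkk.2).elim
        · exact heq
        · exact (hcell k' hk' k hk l hlt hjk' hjk hkk.1.symm hkk.2.symm).elim
    have h3 : ∑ q ∈ (S.K ×ˢ Finset.range l₀).filter (fun q => j q.1 = q.2 + 1), S.ρ q.2
        ≤ F.card := by convert h1
    exact Nat.add_le_add h3 h2
  have hC := hW.sum_exp_le hF
  have hδ := S.twelve_le
  calc ∑ k ∈ S.K, h k ≤ _ := Finset.sum_le_sum hpt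
    _ = ∑ k ∈ S.K, (if 1 ≤ S.X k then 4 else 0) +
        8 * ∑ q ∈ (S.K ×ˢ R).filter (fun q => j q.1 = q.2 + 1), S.ρ q.2 +
        4 * S.δ * ∑ q ∈ (S.K ×ˢ R).filter (fun q => S.exp q.1 q.2), S.ρ q.2 := by
        rw [Finset.sum_add_distrib, Finset.sum_add_distrib, hswap S.exp,
          hswap fun k l => j k = l + 1]
    _ ≤ 16 * F.card + 8 * (F.card + S.δ * (4 * F.card)) + 4 * S.δ * (4 * F.card) := by gcongr
    _ ≤ 52 * S.δ * F.card := by nlinarith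

end Trace
end DMCD

/-! ### The run of the decision rule, in phases -/

namespace DMCD

/-- The ratio of consecutive scales in phase `q`. -/
def delta (q : ℕ) : ℕ := 16 * 2 ^ q

/-- The phase of request number `k` (from `0`): the number of requests is guessed to be at most
`d ^ d`, for `d = delta q`, and the guess is given up when it is exceeded, unless `n ≤ d ^ d`. -/
noncomputable def phase (n k : ℕ) : ℕ := sInf {q | k < delta q ^ delta q ∨ n ≤ delta q ^ delta q}

lemma sixteen_le_delta (q : ℕ) : 16 ≤ delta q := by
  have := Nat.one_le_two_pow (n := q); unfold delta; omega

lemma delta_succ (q : ℕ) : delta (q + 1) = 2 * delta q := by unfold delta; ring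

lemma lt_delta (q : ℕ) : q < delta q := by
  have := Nat.lt_two_pow_self (n := q); unfold delta; omega

lemma sum_delta_le (q : ℕ) : ∑ i ∈ Finset.range (q + 1), delta i ≤ 2 * delta q := by
  induction q with
  | zero => simp; omega
  | succ q ih => rw [Finset.sum_range_succ, delta_succ]; omega

lemma lt_delta_pow (q : ℕ) : q < delta q ^ delta q :=
  (lt_delta q).trans (Nat.lt_pow_self (by have := sixteen_le_delta q; omega))

lemma phase_spec (n k : ℕ) : k < delta (phase n k) ^ delta (phase n k) ∨
    n ≤ delta (phase n k) ^ delta (phase n k) :=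
  Nat.sInf_mem (s := {q | k < delta q ^ delta q ∨ n ≤ delta q ^ delta q})
    ⟨k, Or.inl (lt_delta_pow k)⟩

lemma of_lt_phase {n k q : ℕ} (h : q < phase n k) :
    delta q ^ delta q ≤ k ∧ delta q ^ delta q < n := by
  have := Nat.notMem_of_lt_sInf h
  simp only [Set.mem_ofPred_eq, not_or, not_lt, not_le] at this
  exact this

lemma phase_mono (n : ℕ) {k k' : ℕ} (h : k ≤ k') : phase n k ≤ phase n k' :=
  Nat.sInf_le ((phase_spec n k').imp_left h.trans_lt)

section Run

variable (n : ℕ) (X T : ℕ → ℕ)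

/-- The activity in each phase, before request `k`: request `k` is at position `X k` and time
`T k`. -/
noncomputable def activity : ℕ → ℕ → ℕ → ℕ → ℕ
  | 0 => fun _ _ _ => 0
  | k + 1 => fun q => if phase n k = q then update (delta q) (activity k q) (T k) (X k)
      else activity k q

variable {n X T}

lemma activity_succ {k q : ℕ} (h : phase n k = q) :
    activity n X T (k + 1) q = update (delta q) (activity n X T k q) (T k) (X k) := by
  simp only [activity]; rw [if_pos h]

lemma activity_mono {k k' : ℕ} (h : k ≤ k') (q i p : ℕ) :
    activity n X T k q i p ≤ activity n X T k' q i p := by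
  induction h with
  | refl => exact le_rfl
  | step _ ih =>
    refine ih.trans ?_
    simp only [activity]
    split_ifs
    · exact le_update _ _
    · exact le_rfl

/-- The reason why a position is active. -/
lemma exists_of_lt_activity {k q i p v : ℕ} (h : v < activity n X T k q i p) :
    ∃ k' < k, phase n k' = q ∧ v ≤ T k' + 4 * delta q ^ i ∧ delta q ^ i ∣ p ∧ p ≤ X k' ∧
      (X k' ≤ p + 9 * delta q ^ i ∨ ∃ l, Expensive (delta q) (activity n X T k' q) (T k') (X k') l ∧
        i ≤ l ∧ l ≤ i + delta q ∧ X k' ≤ p + 8 * delta q ^ l) := by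
  induction k generalizing v with
  | zero => simp [activity] at h
  | succ k ih =>
    by_cases hq : phase n k = q
    · rw [activity_succ hq] at h
      by_cases hv : v < activity n X T k q i p
      · obtain ⟨k', hk', h'⟩ := ih hv
        exact ⟨k', by omega, h'⟩
      · unfold update at h
        split_ifs at h with hA
        · have hv' : v ≤ T k + 4 * delta q ^ i := by
            rcases lt_max_iff.1 h with h | h <;> omega
          refine ⟨k, by omega, hq, hv', ?_⟩
          rcases hA with ⟨h1, h2, h3⟩ | ⟨-, h1, -, h2, h3⟩ | ⟨l, h1, h2, h3, h4, h5, h6⟩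
          · obtain ⟨-, -, -, -, hd, -⟩ := ih h1
            exact ⟨hd, h2, Or.inl h3⟩
          · exact ⟨h1, h2, Or.inl (by omega)⟩
          · exact ⟨h4, h5, Or.inr ⟨l, h1, h2, h3, h6⟩⟩
        · exact absurd h hv
    · simp only [activity] at h
      rw [if_neg hq] at h
      obtain ⟨k', hk', h'⟩ := ih h
      exact ⟨k', by omega, h'⟩

/-- A level can be active only if its scale is small compared with the position of a request. -/
lemma exists_lt_of_activity_pos {k q i p : ℕ} (h : 0 < activity n X T k q i p) :
    ∃ k' < k, phase n k' = q ∧ 4 * delta q ^ i < X k' := by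
  have hd := sixteen_le_delta q
  induction k with
  | zero => simp [activity] at h
  | succ k ih =>
    by_cases hk : 0 < activity n X T k q i p
    · obtain ⟨k', hk', h'⟩ := ih hk
      exact ⟨k', by omega, h'⟩
    by_cases hq : phase n k = q
    · rw [activity_succ hq] at h
      unfold update at h
      split_ifs at h with hA
      · refine ⟨k, by omega, hq, ?_⟩
        rcases hA with ⟨h1, -⟩ | ⟨h1, -⟩ | ⟨l, h1, h2, -⟩
        · omega
        · exact lt_of_lt_goodFrom (by omega) h1
        · have := lt_of_not_fair h1.2
          have : delta q ^ i ≤ delta q ^ l := Nat.pow_le_pow_right (by omega) h2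
          omega
      · exact absurd h hk
    · simp only [activity] at h
      rw [if_neg hq] at h
      exact absurd h hk

variable {N : ℕ}

/-- The trace of phase `q`. -/
noncomputable def phaseTrace (n : ℕ) (hT : ∀ i j, i ≤ j → j < N → T i ≤ T j)
    (hinj : ∀ i < N, ∀ j < N, X i = X j → T i = T j → i = j) (q : ℕ) : Trace where
  δ := delta q
  K := (Finset.range N).filter fun k => phase n k = q
  X := X
  T := T
  a k := activity n X T k q
  exp k l := (k < N ∧ phase n k = q) ∧ Expensive (delta q) (activity n X T k q) (T k) (X k) l
  twelve_le := by have := sixteen_le_delta q; omega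
  T_mono i _ j hj hij := hT i j hij (Finset.mem_range.1 (Finset.mem_filter.1 hj).1)
  inj i hi j hj := hinj i (Finset.mem_range.1 (Finset.mem_filter.1 hi).1) j
    (Finset.mem_range.1 (Finset.mem_filter.1 hj).1)
  a_mono i j hij l p := activity_mono hij q l p
  exp_mem k l h := Finset.mem_filter.2 ⟨Finset.mem_range.2 h.1.1, h.1.2⟩
  exp_unique k l l' h h' := by have := h.2.1; have := h'.2.1; omega
  exp_lt k l h := lt_of_not_fair h.2.2
  exp_none k l p h h1 h2 h3 := h.2.2 ⟨p, Or.inr ⟨h1, h2, h3⟩⟩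
  refresh k hk l p h1 h2 h3 := by
    rw [activity_succ (Finset.mem_filter.1 hk).2]
    exact Activates.le_update (Or.inl ⟨h1, h2, h3⟩)
  near k hk l := by
    rw [activity_succ (Finset.mem_filter.1 hk).2]
    exact good_update (by have := sixteen_le_delta q; omega) l
  fill k l i p h h1 h2 h3 h4 h5 := by
    rw [activity_succ h.1.2]
    exact Activates.le_update (Or.inr (Or.inr ⟨l, h.2, h1, h2, h3, h4, h5⟩))

/-- Active positions are accounted for by the trace of their phase. -/
lemma kept_of_lt_activity (hT : ∀ i j, i ≤ j → j < N → T i ≤ T j)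
    (hinj : ∀ i < N, ∀ j < N, X i = X j → T i = T j → i = j)
    {k q i p v : ℕ} (hk : k ≤ N) (hv : ∀ k' < k, T k' ≤ v)
    (h : v < activity n X T k q i p) : (phaseTrace n hT hinj q).Kept p v := by
  obtain ⟨k₁, hk₁, hq₁, hx₁⟩ := exists_lt_of_activity_pos (by omega : 0 < activity n X T k q i p)
  obtain ⟨k₂, hk₂, hq₂, h1, h2, h3, h4⟩ := exists_of_lt_activity h
  have hm : ∀ k' < k, phase n k' = q → k' ∈ (phaseTrace n hT hinj q).K := fun k' h h' =>
    Finset.mem_filter.2 ⟨Finset.mem_range.2 (by omega), h'⟩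
  refine ⟨i, ⟨k₁, hm k₁ hk₁ hq₁, hx₁⟩, k₂, hm k₂ hk₂ hq₂, hv k₂ hk₂, h1, h2, h3, ?_⟩
  rcases h4 with h4 | ⟨l, h4, h5, h6, h7⟩
  · exact Or.inl h4
  · exact Or.inr ⟨l, ⟨⟨by omega, hq₂⟩, h4⟩, h5, h6, h7⟩

/-- In a phase with `K` requests, `l₀` is the least level with `f < |K| * ρ l₀`. As the positions
are at most `f` and `|K| ≤ d ^ d`, they are at most `ρ (l₀ + d)`. If the phase is the last one
because of `n ≤ d ^ d`, all positions are at most `ρ d`, and `l₀ = 0`. -/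
lemma exists_window (hT : ∀ i j, i ≤ j → j < N → T i ≤ T j)
    (hinj : ∀ i < N, ∀ j < N, X i = X j → T i = T j → i = j)
    (q f : ℕ) (hX : ∀ k < N, X k < n) (hf : ∀ k < N, X k ≤ f) :
    ∃ l₀, (phaseTrace n hT hinj q).Window f l₀ := by
  set S := phaseTrace n hT hinj q with hS
  have hd := sixteen_le_delta q
  have hmem : ∀ k ∈ S.K, k < N ∧ phase n k = q := fun k hk =>
    ⟨Finset.mem_range.1 (Finset.mem_filter.1 hk).1, (Finset.mem_filter.1 hk).2⟩
  by_cases hn : n ≤ delta q ^ delta q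
  · refine ⟨0, fun l hl => by omega, fun k hk => ?_⟩
    have h1 := hX k (hmem k hk).1
    have h2 : S.ρ (0 + S.δ) = delta q ^ delta q := by rw [zero_add]; rfl
    show X k ≤ _
    omega
  rcases S.K.eq_empty_or_nonempty with h | h
  · exact ⟨0, fun l hl => by omega, fun k hk => by simp [h] at hk⟩
  have hcard : S.K.card ≤ S.ρ S.δ := by
    rw [← Finset.card_range (S.ρ S.δ)]
    refine Finset.card_le_card fun k hk => Finset.mem_range.2 ?_
    have h1 := phase_spec n k
    rw [(hmem k hk).2] at h1
    exact h1.resolve_right hn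
  have hex : ∃ l, f < S.K.card * S.ρ l := by
    refine ⟨f, ?_⟩
    have h1 : f < S.ρ f := Nat.lt_pow_self (by show 1 < delta q; omega)
    have h2 := h.card_pos
    nlinarith
  refine ⟨Nat.find hex, fun l hl => not_lt.1 (Nat.find_min hex hl), fun k hk => ?_⟩
  have h1 := Nat.find_spec hex
  have h2 := hf k (hmem k hk).1
  have h3 : S.ρ (Nat.find hex + S.δ) = S.ρ S.δ * S.ρ (Nat.find hex) := by
    unfold Trace.ρ; rw [pow_add, mul_comm]
  have h4 := Nat.mul_le_mul_right (S.ρ (Nat.find hex)) hcard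
  show X k ≤ _
  omega

/-- Two requests with the same last level that is not good lie in different cells of that level:
the first one activates a copy that makes the level good for the second one. -/
lemma cells_ne {k k' q l : ℕ} (hk : phase n k = q) (hkk : k < k') (hTkk : T k ≤ T k')
    (h : goodFrom (delta q) (activity n X T k q) (T k) (X k) = l + 1)
    (h' : goodFrom (delta q) (activity n X T k' q) (T k') (X k') = l + 1)
    (hx : X k / delta q ^ l = X k' / delta q ^ l) : T k / delta q ^ l ≠ T k' / delta q ^ l := by
  intro ht
  have hd := sixteen_le_delta q
  have hpos : 0 < delta q ^ l := pow_pos (by omega) l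
  obtain ⟨hA, h1, h2⟩ := activates_grid (by omega) (by omega :
    l < goodFrom (delta q) (activity n X T k q) (T k) (X k))
  have h3 := hA.le_update
  rw [← activity_succ hk] at h3
  have h4 := h3.trans (activity_mono (Nat.succ_le_of_lt hkk) q l _)
  refine not_good_of_goodFrom (by omega) h'
    ⟨(X k / delta q ^ l - 2) * delta q ^ l, Or.inr ⟨?_, ?_, ?_⟩⟩
  · have h5 := Nat.div_mul_le_self (T k) (delta q ^ l)
    have h6 := Nat.lt_div_mul_add (a := T k') hpos
    rw [← ht] at h6
    omega
  all_goals
    have h5 := lt_of_lt_goodFrom (by omega) (by omega :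
      l < goodFrom (delta q) (activity n X T k' q) (T k') (X k'))
    have h6 := grid_bounds (g := 2) (x := X k') hpos (by omega)
    rw [← hx] at h6
    omega

/-- The cost of serving the requests of one phase. -/
lemma sum_source_le (hT : ∀ i j, i ≤ j → j < N → T i ≤ T j)
    (hinj : ∀ i < N, ∀ j < N, X i = X j → T i = T j → i = j)
    {α : Type*} {F : Finset α} {hx ht : α → ℕ}
    (hF : ∀ k < N, Covers F hx ht (X k) (T k)) (hX : ∀ k < N, X k < n)
    (hf : ∀ k < N, X k ≤ F.card) (q : ℕ) :
    ∑ k ∈ (Finset.range N).filter (fun k => phase n k = q),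
      (X k - source (delta q) (activity n X T k q) (T k) (X k)) ≤ 52 * delta q * F.card := by
  obtain ⟨l₀, hW⟩ := exists_window hT hinj q F.card hX hf
  have hd := sixteen_le_delta q
  have hmem : ∀ k ∈ (phaseTrace n hT hinj q).K, k < N ∧ phase n k = q := fun k hk =>
    ⟨Finset.mem_range.1 (Finset.mem_filter.1 hk).1, (Finset.mem_filter.1 hk).2⟩
  refine hW.sum_horizontal_le (fun k hk => hF k (hmem k hk).1) _
    (fun k => goodFrom (delta q) (activity n X T k q) (T k) (X k))
    (fun k _ => Nat.sub_le _ _) ?_ ?_ ?_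
  · intro k _ h
    simpa using (source_zero (by omega) h).sub_le
  · intro k hk l h
    refine ⟨lt_of_lt_goodFrom (d := delta q) (by omega)
      (by omega : l < goodFrom (delta q) (activity n X T k q) (T k) (X k)), ?_⟩
    by_cases hfair : Fair (delta q) (activity n X T k q) (T k) (X k) l
    · exact Or.inl (source_fair h hfair).sub_le
    · refine Or.inr ⟨⟨hmem k hk, h, hfair⟩, ?_⟩
      have := (source_expensive (by omega) ⟨h, hfair⟩).sub_le
      rw [pow_succ] at this
      refine this.trans (le_of_eq ?_)
      show 4 * (delta q ^ l * delta q) = 4 * delta q * delta q ^ l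
      ring
  · intro k hk k' hk' l hlt h h' hxx
    exact cells_ne (hmem k hk).2 hlt (hT k k' hlt.le (hmem k' hk').1) h h' hxx

/-- The cost of the copies stored because of the requests of one phase. -/
lemma exists_kept_set (hT : ∀ i j, i ≤ j → j < N → T i ≤ T j)
    (hinj : ∀ i < N, ∀ j < N, X i = X j → T i = T j → i = j)
    {α : Type*} {F : Finset α} {hx ht : α → ℕ}
    (hF : ∀ k < N, Covers F hx ht (X k) (T k)) (hX : ∀ k < N, X k < n)
    (hf : ∀ k < N, X k ≤ F.card) (q : ℕ) :
    ∃ B : Finset (ℕ × ℕ), B.card ≤ 410 * delta q * F.card ∧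
      ∀ p v, 0 < p → (phaseTrace n hT hinj q).Kept p v → (p, v) ∈ B := by
  obtain ⟨l₀, hW⟩ := exists_window hT hinj q F.card hX hf
  exact hW.exists_kept fun k hk => hF k (Finset.mem_range.1 (Finset.mem_filter.1 hk).1)

end Run
end DMCD

/-! ### Paths and optimal solutions -/

namespace DMCD

variable {n : ℕ} {v₀ : Fin n}

/-- A path from the origin has an edge at every distance from its end. -/
lemma Reaches.covers {F : Finset (DirPair n)} (hF : (F : Set (DirPair n)) ⊆ edges n)
    {r : Replica n} (h : Reaches F (v₀, 0) r) :
    v₀ ≤ r.1 ∧ Covers F (fun e => (e.2.1 : ℕ) - v₀) (fun e => e.2.2) ((r.1 : ℕ) - v₀) r.2 := by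
  induction h with
  | refl => exact ⟨le_rfl, fun d hd => by simp at hd⟩
  | @tail b c _ hbc ih =>
    obtain ⟨h1, h2⟩ := ih
    have h1' : (v₀ : ℕ) ≤ b.1 := h1
    have hstep : (v₀ : ℕ) ≤ c.1 ∧ (b.1 : ℕ) ≤ c.1 ∧ b.2 ≤ c.2 ∧
        (c.1 : ℕ) + c.2 = b.1 + b.2 + 1 := by
      rcases hF hbc with ⟨h3, h4⟩ | ⟨h3, h4⟩
      · simp only at h3 h4; omega
      · have h3' : (b.1 : ℕ) = c.1 := congrArg Fin.val h3
        simp only at h4; omega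
    refine ⟨hstep.1, fun d hd => ?_⟩
    rcases d with _ | d
    · exact ⟨(b, c), hbc, le_rfl, le_rfl, by simp⟩
    · obtain ⟨e, he, h5, h6, h7⟩ := h2 d (by omega)
      exact ⟨e, he, by omega, by omega, by omega⟩

lemma Covers.add_le_card {α : Type*} {F : Finset α} {hx ht : α → ℕ} {x t : ℕ}
    (h : Covers F hx ht x t) : x + t ≤ F.card := by
  rw [← Finset.card_range (x + t)]
  refine (Finset.card_le_card fun d hd => ?_).trans
    (Finset.card_image_le (s := F) (f := fun e => (x - hx e) + (t - ht e)))
  obtain ⟨e, he, -, -, h3⟩ := h d (Finset.mem_range.1 hd)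
  exact Finset.mem_image.2 ⟨e, he, h3⟩

lemma reaches_up {F : Finset (DirPair n)} (w : Fin n) {s t : ℕ} (hst : s ≤ t)
    (h : ∀ j, s ≤ j → j < t → ((w, j), (w, j + 1)) ∈ F) : Reaches F (w, s) (w, t) := by
  induction t, hst using Nat.le_induction with
  | base => exact Relation.ReflTransGen.refl
  | succ t hst ih => exact (ih fun j h1 h2 => h j h1 (by omega)).tail (h t hst (by omega))

lemma reaches_right {F : Finset (DirPair n)} {u w : Fin n} (t : ℕ) (huw : u ≤ w)
    (h : horizontalPath u w t ⊆ F) : Reaches F (u, t) (w, t) := by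
  obtain ⟨w, hw⟩ := w
  have huw' : (u : ℕ) ≤ w := huw
  clear huw
  induction w, huw' using Nat.le_induction with
  | base => exact Relation.ReflTransGen.refl
  | succ w huw ih =>
    have h1 : horizontalPath u ⟨w, by omega⟩ t ⊆ F := fun e he => h <| by
      obtain ⟨p, hp, rfl⟩ := Finset.mem_image.1 he
      obtain ⟨-, h4, h2, h3⟩ := Finset.mem_filter.1 hp
      refine Finset.mem_image.2 ⟨p, Finset.mem_filter.2 ⟨Finset.mem_univ _, h4, h2, ?_⟩, rfl⟩
      have h3' : (p.2 : ℕ) ≤ w := h3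
      show (p.2 : ℕ) ≤ w + 1
      omega
    exact Relation.ReflTransGen.tail (ih (by omega) h1) (h <|
      Finset.mem_image.2 ⟨(⟨w, by omega⟩, ⟨w + 1, hw⟩),
        Finset.mem_filter.2 ⟨Finset.mem_univ _, huw, rfl, le_rfl⟩, rfl⟩)

lemma Reaches.mono {F G : Finset (DirPair n)} (h : F ⊆ G) {p q : Replica n} (hF : Reaches F p q) :
    Reaches G p q := Relation.ReflTransGen.mono (fun _ _ hab => h hab) _ _ hF

lemma horizontalPath_subset_edges (u w : Fin n) (t : ℕ) :
    (horizontalPath u w t : Set (DirPair n)) ⊆ edges n := by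
  intro e he
  obtain ⟨p, hp, rfl⟩ := Finset.mem_image.1 (Finset.mem_coe.1 he)
  exact Or.inl ⟨(Finset.mem_filter.1 hp).2.2.1, rfl⟩

lemma card_horizontalPath_le (u w : Fin n) (t : ℕ) :
    (horizontalPath u w t).card ≤ (w : ℕ) - u := by
  refine Finset.card_image_le.trans ?_
  rw [← Nat.card_Ico]
  refine Finset.card_le_card_of_injOn (fun p => (p.1 : ℕ)) ?_ ?_
  · intro p hp
    obtain ⟨-, h1, h2, h3⟩ := Finset.mem_filter.1 (Finset.mem_coe.1 hp)
    have h1' : (u : ℕ) ≤ p.1 := h1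
    have h3' : (p.2 : ℕ) ≤ w := h3
    simp only [Finset.coe_Ico, Set.mem_Ico]
    omega
  · intro p hp p' hp' h
    obtain ⟨-, -, h2, -⟩ := Finset.mem_filter.1 (Finset.mem_coe.1 hp)
    obtain ⟨-, -, h2', -⟩ := Finset.mem_filter.1 (Finset.mem_coe.1 hp')
    have h : (p.1 : ℕ) = p'.1 := h
    exact Prod.ext (Fin.ext h) (Fin.ext (by omega))

lemma exists_isFeasible (R : Requests v₀) : ∃ F, IsFeasible R F := by
  obtain ⟨M, hM⟩ : ∃ M, ∀ r ∈ R.list, r.2 ≤ M :=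
    ⟨(R.list.map Prod.snd).sum, fun r hr => List.le_sum_of_mem (List.mem_map_of_mem hr)⟩
  refine ⟨Finset.univ.biUnion (fun w : Fin n => horizontalPath v₀ w 0) ∪
    (Finset.range M).biUnion fun t => storageArcs Finset.univ t, ?_, fun r hr => ?_⟩
  · intro e he
    simp only [Finset.coe_union, Set.mem_union, Finset.mem_coe, Finset.mem_biUnion] at he
    rcases he with ⟨w, -, he⟩ | ⟨t, -, he⟩
    · exact horizontalPath_subset_edges _ _ _ he
    · obtain ⟨w, -, rfl⟩ := Finset.mem_image.1 he
      exact Or.inr ⟨rfl, rfl⟩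
  · refine Relation.ReflTransGen.trans (b := (r.1.1, 0))
      (reaches_right 0 r.1.2 ?_) (reaches_up _ (Nat.zero_le _) ?_)
    · exact (Finset.subset_biUnion_of_mem (fun w : Fin n => horizontalPath v₀ w 0)
        (Finset.mem_univ r.1.1)).trans Finset.subset_union_left
    · intro j _ hj
      refine Finset.mem_union_right _ (Finset.mem_biUnion.2 ⟨j, ?_, ?_⟩)
      · exact Finset.mem_range.2 (hj.trans_le (hM r hr))
      · exact Finset.mem_image.2 ⟨r.1.1, Finset.mem_univ _, rfl⟩

lemma exists_card_eq_opt (R : Requests v₀) : ∃ F, IsFeasible R F ∧ F.card = opt R :=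
  let ⟨F, hF⟩ := exists_isFeasible R
  Nat.sInf_mem (s := {k | ∃ F : Finset (DirPair n), IsFeasible R F ∧ F.card = k})
    ⟨F.card, F, hF, rfl⟩

/-! ### The online algorithm -/

/-- The node at distance `p` from the origin; `v₀` if there is none. -/
def node (v₀ : Fin n) (p : ℕ) : Fin n := if h : v₀ + p < n then ⟨v₀ + p, h⟩ else v₀

lemma node_val {p : ℕ} (h : v₀ + p < n) : (node v₀ p : ℕ) = v₀ + p := by
  unfold node; rw [dif_pos h]

lemma node_sub {w : Fin n} (h : v₀ ≤ w) : node v₀ ((w : ℕ) - v₀) = w := by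
  have h' : (v₀ : ℕ) ≤ w := h
  have := w.2
  exact Fin.ext (by rw [node_val (by omega)]; omega)

/-- The memory of the algorithm: the time, the number of requests so far, the activity in each
phase, and the current solution. -/
structure Memory (n : ℕ) where
  time : ℕ
  count : ℕ
  act : ℕ → ℕ → ℕ → ℕ
  sol : Finset (DirPair n)

/-- The initial memory. -/
def Memory.init (n : ℕ) : Memory n := ⟨0, 0, fun _ _ _ => 0, ∅⟩

/-- The position from which the algorithm serves a request at `v`. -/
noncomputable def Memory.source (s : Memory n) (v₀ v : Fin n) : ℕ :=
  DMCD.source (delta (phase n s.count)) (s.act (phase n s.count)) s.time ((v : ℕ) - v₀)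

open Classical in
/-- The nodes stored at a time event: the origin and the positions active at the next time. -/
noncomputable def Memory.stored (s : Memory n) (v₀ : Fin n) : Finset (Fin n) :=
  Finset.univ.filter fun w => w = v₀ ∨ v₀ ≤ w ∧ ∃ q i, s.time + 1 < s.act q i ((w : ℕ) - v₀)

lemma Memory.mem_stored {s : Memory n} {w : Fin n} : w ∈ s.stored v₀ ↔
    w = v₀ ∨ v₀ ≤ w ∧ ∃ q i, s.time + 1 < s.act q i ((w : ℕ) - v₀) := by
  simp [Memory.stored]

/-- The reaction of the algorithm to an event. -/
noncomputable def Memory.step (s : Memory n) : Event v₀ → Memory n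
  | Event.request v =>
    { time := s.time
      count := s.count + 1
      act := fun q => if phase n s.count = q then
        update (delta q) (s.act q) s.time ((v.1 : ℕ) - v₀) else s.act q
      sol := s.sol ∪ horizontalPath (node v₀ (s.source v₀ v.1)) v.1 s.time }
  | Event.tick =>
    { time := s.time + 1
      count := s.count
      act := s.act
      sol := s.sol ∪ storageArcs (s.stored v₀) s.time }

/-- The memory after a history of events. -/
noncomputable def memory (h : List (Event v₀)) : Memory n := h.foldl Memory.step (Memory.init n)

lemma memory_append (h : List (Event v₀)) (e : Event v₀) :
    memory (h ++ [e]) = (memory h).step e := by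
  simp [memory, List.foldl_append]

/-- The current solution has copies at the origin and at all active positions. -/
structure Memory.Valid (s : Memory n) (v₀ : Fin n) : Prop where
  origin : HasCopy v₀ s.sol v₀ s.time
  active : ∀ q i p, s.time < s.act q i p → v₀ + p < n ∧ HasCopy v₀ s.sol (node v₀ p) s.time

lemma HasCopy.mono {F G : Finset (DirPair n)} (h : F ⊆ G) {w : Fin n} {t : ℕ}
    (hF : HasCopy v₀ F w t) : HasCopy v₀ G w t :=
  hF.imp_right fun ⟨e, he, h'⟩ => ⟨e, h he, h'⟩

lemma node_zero : node v₀ 0 = v₀ := by have := node_sub (le_refl v₀); simpa using this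

lemma hasCopy_union_horizontalPath {F : Finset (DirPair n)} {u w v : Fin n} {t : ℕ}
    (hu : HasCopy v₀ F u t) (huw : u ≤ w) (hwv : w ≤ v) :
    HasCopy v₀ (F ∪ horizontalPath u v t) w t := by
  rcases eq_or_lt_of_le huw with rfl | hlt
  · exact hu.mono Finset.subset_union_left
  · have hlt' : (u : ℕ) < w := hlt
    have hw := w.2
    refine Or.inr ⟨((⟨(w : ℕ) - 1, by omega⟩, t), (w, t)), Finset.mem_union_right _
      (Finset.mem_image.2 ⟨(⟨(w : ℕ) - 1, by omega⟩, w), Finset.mem_filter.2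
        ⟨Finset.mem_univ _, ?_, ?_, hwv⟩, rfl⟩), Or.inr rfl⟩
    · show (u : ℕ) ≤ (w : ℕ) - 1
      omega
    · show (w : ℕ) - 1 + 1 = w
      omega

lemma Memory.source_le (s : Memory n) (v : Fin n) : s.source v₀ v ≤ (v : ℕ) - v₀ :=
  DMCD.source_le (by have := sixteen_le_delta (phase n s.count); omega)

lemma Memory.Valid.source {s : Memory n} (hs : s.Valid v₀) {v : Fin n} (hv : v₀ ≤ v) :
    node v₀ (s.source v₀ v) ≤ v ∧ HasCopy v₀ s.sol (node v₀ (s.source v₀ v)) s.time := by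
  have hv' : (v₀ : ℕ) ≤ v := hv
  have h1 := s.source_le (v₀ := v₀) v
  have hvn := v.2
  constructor
  · show (node v₀ _ : ℕ) ≤ v
    rw [node_val (by omega)]
    omega
  · rcases source_eq_zero_or (d := delta (phase n s.count)) (a := s.act (phase n s.count))
      (t := s.time) (x := (v : ℕ) - v₀) (by have := sixteen_le_delta (phase n s.count); omega)
      with h | ⟨i, h⟩
    · rw [show s.source v₀ v = 0 from h, node_zero]
      exact hs.origin
    · exact (hs.active _ i _ h).2

lemma Memory.Valid.stored {s : Memory n} (hs : s.Valid v₀) :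
    (s.stored v₀).Nonempty ∧ ∀ w ∈ s.stored v₀, HasCopy v₀ s.sol w s.time := by
  refine ⟨⟨v₀, Memory.mem_stored.2 (Or.inl rfl)⟩, fun w hw => ?_⟩
  rcases Memory.mem_stored.1 hw with rfl | ⟨hw, q, i, h⟩
  · exact hs.origin
  · have := (hs.active q i ((w : ℕ) - v₀) (by omega)).2
    rwa [node_sub hw] at this

lemma Memory.Valid.step {s : Memory n} (hs : s.Valid v₀) (e : Event v₀) : (s.step e).Valid v₀ := by
  rcases e with v | _
  · have hv' : (v₀ : ℕ) ≤ v.1 := v.2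
    have hvn := v.1.2
    refine ⟨hs.origin.mono Finset.subset_union_left, fun q i p h => ?_⟩
    have hmono : ∀ {p}, s.time < s.act q i p → v₀ + p < n ∧
        HasCopy v₀ (s.step (Event.request v)).sol (node v₀ p) s.time := fun h' =>
      (hs.active q i _ h').imp_right fun h'' => h''.mono Finset.subset_union_left
    simp only [Memory.step] at h
    split_ifs at h with hq
    · unfold update at h
      split_ifs at h with hA
      · obtain ⟨h1, h2⟩ := hA.le (by have := sixteen_le_delta q; omega)
        rcases h2 with h2 | h2
        · exact hmono h2
        · subst hq
          obtain ⟨h3, h4⟩ := hs.source v.2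
          have h5 := s.source_le (v₀ := v₀) v.1
          refine ⟨by omega, hasCopy_union_horizontalPath h4 ?_ ?_⟩
          · show (node v₀ _ : ℕ) ≤ node v₀ p
            rw [node_val (by omega), node_val (by omega)]
            exact Nat.add_le_add_left h2 _
          · show (node v₀ p : ℕ) ≤ v.1
            rw [node_val (by omega)]
            omega
      · exact hmono h
    · exact hmono h
  · have hst : ∀ w ∈ s.stored v₀, HasCopy v₀ (s.step (Event.tick : Event v₀)).sol w (s.time + 1) :=
      fun w hw => Or.inr ⟨((w, s.time), (w, s.time + 1)),
        Finset.mem_union_right _ (Finset.mem_image.2 ⟨w, hw, rfl⟩), Or.inr rfl⟩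
    refine ⟨hst v₀ (Memory.mem_stored.2 (Or.inl rfl)), fun q i p h => ?_⟩
    have h' : s.time + 1 < s.act q i p := h
    have hp := (hs.active q i p (by omega)).1
    refine ⟨hp, hst _ (Memory.mem_stored.2 (Or.inr ⟨?_, q, i, ?_⟩))⟩
    · show (v₀ : ℕ) ≤ node v₀ p
      rw [node_val hp]
      omega
    · rw [node_val hp, Nat.add_sub_cancel_left]
      exact h'

lemma clock_append (h : List (Event v₀)) (e : Event v₀) :
    clock (h ++ [e]) = clock h + clock [e] := by
  induction h with
  | nil => simp [clock]
  | cons a h ih => cases a <;> simp only [List.cons_append, clock, ih]; omega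

lemma memory_valid (h : List (Event v₀)) : (memory h).Valid v₀ ∧ (memory h).time = clock h := by
  induction h using List.reverseRecOn with
  | nil => exact ⟨⟨Or.inl rfl, fun q i p h => absurd h (Nat.not_lt_zero _)⟩, rfl⟩
  | append_singleton h e ih =>
    rw [memory_append, clock_append]
    refine ⟨ih.1.step e, ?_⟩
    cases e <;> simp [Memory.step, clock, ih.2]

/-- The multi-scale algorithm. -/
noncomputable def scaleAlg (n : ℕ) (v₀ : Fin n) : OnlineAlg v₀ where
  sol h := (memory h).sol
  sol_nil := rfl
  sol_request h v := by
    obtain ⟨hV, ht⟩ := memory_valid h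
    obtain ⟨h1, h2⟩ := hV.source v.2
    rw [← ht]
    exact ⟨_, h1, h2, by rw [memory_append]; rfl⟩
  sol_tick h := by
    obtain ⟨hV, ht⟩ := memory_valid h
    obtain ⟨h1, h2⟩ := hV.stored
    rw [← ht]
    exact ⟨_, h1, h2, by rw [memory_append]; rfl⟩

end DMCD

/-! ### The cost of the online algorithm -/

namespace DMCD

variable {n : ℕ} {v₀ : Fin n}

/-- The position, relative to the origin, of request number `k` of a list; `0` if there is none. -/
def reqPos (L : List (Set.Ici v₀ × ℕ)) (k : ℕ) : ℕ := (L[k]?).elim 0 fun r => (r.1.1 : ℕ) - v₀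

/-- The time of request number `k` of a list; `0` if there is none. -/
def reqTime (L : List (Set.Ici v₀ × ℕ)) (k : ℕ) : ℕ := (L[k]?).elim 0 fun r => r.2

lemma reqPos_eq {L : List (Set.Ici v₀ × ℕ)} {k : ℕ} (h : k < L.length) :
    reqPos L k = (L[k].1.1 : ℕ) - v₀ := by simp [reqPos, h]

lemma reqTime_eq {L : List (Set.Ici v₀ × ℕ)} {k : ℕ} (h : k < L.length) :
    reqTime L k = L[k].2 := by simp [reqTime, h]

lemma Requests.reqTime_mono (R : Requests v₀) (i j : ℕ) (hij : i ≤ j) (hj : j < R.num) :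
    reqTime R.list i ≤ reqTime R.list j := by
  rcases hij.eq_or_lt with rfl | hlt
  · exact le_rfl
  · have hj' : j < R.list.length := hj
    rw [reqTime_eq (by omega), reqTime_eq hj']
    exact List.pairwise_iff_getElem.1 R.sorted i j (by omega) hj' hlt

lemma Requests.req_inj (R : Requests v₀) (i : ℕ) (hi : i < R.num) (j : ℕ) (hj : j < R.num)
    (hX : reqPos R.list i = reqPos R.list j) (hT : reqTime R.list i = reqTime R.list j) :
    i = j := by
  have hi' : i < R.list.length := hi
  have hj' : j < R.list.length := hj
  rw [reqPos_eq hi', reqPos_eq hj'] at hX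
  rw [reqTime_eq hi', reqTime_eq hj'] at hT
  refine (R.nodup.getElem_inj_iff (hi := hi') (hj := hj')).1
    (Prod.ext (Subtype.ext (Fin.ext ?_)) hT)
  have h1 : (v₀ : ℕ) ≤ R.list[i].1.1 := R.list[i].1.2
  have h2 : (v₀ : ℕ) ≤ R.list[j].1.1 := R.list[j].1.2
  omega

/-- The trace of phase `q` for an ordered set of requests. -/
noncomputable def Requests.trace (R : Requests v₀) (q : ℕ) : Trace :=
  phaseTrace n R.reqTime_mono R.req_inj q

/-- The position from which request number `k` is served. -/
noncomputable def Requests.src (R : Requests v₀) (k : ℕ) : ℕ :=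
  source (delta (phase n k)) (activity n (reqPos R.list) (reqTime R.list) k (phase n k))
    (reqTime R.list k) (reqPos R.list k)

/-- The edges of the path that serves request number `k`. -/
noncomputable def Requests.path (R : Requests v₀) (k : ℕ) : Finset (DirPair n) :=
  horizontalPath (node v₀ (R.src k)) (node v₀ (reqPos R.list k)) (reqTime R.list k)

/-- The arc at position `p` that arrives at time `v`. -/
def arcTo (v₀ : Fin n) (c : ℕ × ℕ) : DirPair n := ((node v₀ c.1, c.2 - 1), (node v₀ c.1, c.2))

/-- The memory `s` is what the algorithm has before request number `k`, and all edges of its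
solution are accounted for. -/
structure Accounted (R : Requests v₀) (M k : ℕ) (s : Memory n) : Prop where
  count : s.count = k
  act : s.act = activity n (reqPos R.list) (reqTime R.list) k
  time_ge : ∀ j < k, reqTime R.list j ≤ s.time
  time_le : s.time ≤ M
  edges : ∀ e ∈ s.sol, (∃ j < R.num, e ∈ R.path j) ∨
    ∃ p v, 1 ≤ v ∧ v ≤ M ∧ e = arcTo v₀ (p, v) ∧ (p = 0 ∨ ∃ q, (R.trace q).Kept p v)

variable {R : Requests v₀} {M k : ℕ} {s : Memory n}

lemma Accounted.tick (h : Accounted R M k s) (hk : k ≤ R.num) (hM : s.time + 1 ≤ M) :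
    Accounted R M k (s.step (Event.tick : Event v₀)) := by
  refine ⟨h.count, h.act, fun j hj => (h.time_ge j hj).trans (Nat.le_succ _), hM, fun e he => ?_⟩
  rcases Finset.mem_union.1 he with he | he
  · exact h.edges e he
  · obtain ⟨w, hw, rfl⟩ := Finset.mem_image.1 he
    right
    rcases Memory.mem_stored.1 hw with rfl | ⟨hw, q, i, hq⟩
    · exact ⟨0, s.time + 1, by omega, hM, by simp [arcTo, node_zero], Or.inl rfl⟩
    · refine ⟨(w : ℕ) - v₀, s.time + 1, by omega, hM, by simp [arcTo, node_sub hw], Or.inr ⟨q, ?_⟩⟩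
      rw [h.act] at hq
      exact kept_of_lt_activity R.reqTime_mono R.req_inj hk
        (fun j hj => (h.time_ge j hj).trans (Nat.le_succ _)) hq

lemma Accounted.ticks (h : Accounted R M k s) (hk : k ≤ R.num) (m : ℕ) (hM : s.time + m ≤ M) :
    Accounted R M k ((List.replicate m (Event.tick : Event v₀)).foldl Memory.step s) ∧
      ((List.replicate m (Event.tick : Event v₀)).foldl Memory.step s).time = s.time + m := by
  induction m generalizing s with
  | zero => exact ⟨h, rfl⟩
  | succ m ih =>
    obtain ⟨h1, h2⟩ := ih (h.tick hk (by omega)) (by show s.time + 1 + m ≤ M; omega)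
    refine ⟨h1, h2.trans ?_⟩
    show s.time + 1 + m = _
    omega

lemma Accounted.request (h : Accounted R M k s) (hk : k < R.list.length)
    (ht : s.time = reqTime R.list k) :
    Accounted R M (k + 1) (s.step (Event.request R.list[k].1)) := by
  have hx := reqPos_eq hk
  refine ⟨by simp [Memory.step, h.count], ?_, fun j hj => ?_, h.time_le, fun e he => ?_⟩
  · funext q
    simp only [Memory.step, activity, h.count, h.act, ht, hx]
  · show _ ≤ s.time
    rw [ht]
    exact R.reqTime_mono j k (by omega) hk
  · rcases Finset.mem_union.1 he with he | he
    · exact h.edges e he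
    · refine Or.inl ⟨k, hk, ?_⟩
      have h1 : s.source v₀ R.list[k].1.1 = R.src k := by
        unfold Memory.source Requests.src
        rw [h.count, h.act, ht, hx]
      have h2 : R.list[k].1.1 = node v₀ (reqPos R.list k) := by
        rw [hx, node_sub R.list[k].1.2]
      rw [h1, ht, h2] at he
      exact he

lemma Accounted.final (hM : ∀ j < R.num, reqTime R.list j ≤ M) (l : List (Set.Ici v₀ × ℕ))
    (hl : R.list.drop k = l) (h : Accounted R M k s) (hk : k ≤ R.num)
    (ht : k < R.num → s.time ≤ reqTime R.list k) :
    Accounted R M R.num ((eventsFrom s.time l).foldl Memory.step s) := by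
  induction l generalizing k s with
  | nil =>
    have : R.list.length ≤ k := List.drop_eq_nil_iff.1 hl
    have : k = R.num := le_antisymm hk this
    subst this
    exact h
  | cons r l ih =>
    have hk' : k < R.list.length := by
      by_contra hlen
      rw [List.drop_eq_nil_iff.2 (not_lt.1 hlen)] at hl
      exact List.cons_ne_nil _ _ hl.symm
    rw [List.drop_eq_getElem_cons hk'] at hl
    obtain ⟨rfl, hl'⟩ := List.cons.inj hl
    have ht' := ht hk'
    have hT := reqTime_eq hk'
    have hMk := hM k hk'
    obtain ⟨h1, h2⟩ := h.ticks hk (R.list[k].2 - s.time) (by omega)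
    rw [eventsFrom, List.foldl_append, List.foldl_cons]
    set s' := (List.replicate (R.list[k].2 - s.time) (Event.tick : Event v₀)).foldl Memory.step s
    have h3 : s'.time = reqTime R.list k := by omega
    have h4 := h1.request hk' h3
    have h5 : R.list[k].2 = (s'.step (Event.request R.list[k].1)).time := by
      show _ = s'.time
      omega
    rw [h5]
    refine ih hl' h4 hk' fun hk2 => ?_
    show s'.time ≤ _
    rw [h3]
    exact R.reqTime_mono k (k + 1) (by omega) hk2

lemma reqPos_lt (hk : k < R.num) : v₀ + reqPos R.list k < n := by
  have hk' : k < R.list.length := hk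
  have h1 : (v₀ : ℕ) ≤ R.list[k].1.1 := R.list[k].1.2
  have := R.list[k].1.1.2
  rw [reqPos_eq hk']
  omega

lemma Requests.src_le (R : Requests v₀) (k : ℕ) : R.src k ≤ reqPos R.list k :=
  source_le (by have := sixteen_le_delta (phase n k); omega)

/-- The algorithm is competitive up to a constant times the parameter of its last phase. -/
theorem cost_scaleAlg_le (R : Requests v₀) :
    (scaleAlg n v₀).cost R ≤ 925 * delta (phase n (R.num - 1)) * opt R := by
  classical
  obtain ⟨F, ⟨hFe, hFr⟩, hF⟩ := exists_card_eq_opt R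
  have hcov : ∀ k < R.num, Covers F (fun e => (e.2.1 : ℕ) - v₀) (fun e => e.2.2)
      (reqPos R.list k) (reqTime R.list k) := fun k hk => by
    have hk' : k < R.list.length := hk
    rw [reqPos_eq hk', reqTime_eq hk']
    exact ((hFr _ (List.getElem_mem hk')).covers hFe).2
  have hcard := fun k hk => (hcov k hk).add_le_card
  have hX : ∀ k < R.num, reqPos R.list k < n := fun k hk => by
    have := reqPos_lt hk; omega
  set Q := phase n (R.num - 1) with hQ
  choose B hB hBmem using exists_kept_set (n := n) R.reqTime_mono R.req_inj hcov hX
    (fun k hk => by have := hcard k hk; omega)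
  have hacc : Accounted R F.card R.num (memory R.events) := by
    refine Accounted.final (s := Memory.init n) (fun j hj => ?_) R.list (List.drop_zero) ?_
      (Nat.zero_le _) fun _ => Nat.zero_le _
    · have := hcard j hj; omega
    · exact ⟨rfl, rfl, fun j hj => by omega, Nat.zero_le _, fun e he => by simp [Memory.init] at he⟩
  have hphase : ∀ k < R.num, phase n k ∈ Finset.range (Q + 1) := fun k hk =>
    Finset.mem_range.2 (Nat.lt_succ_of_le (phase_mono n (by omega)))
  have hsub : (memory R.events).sol ⊆ ((Finset.range R.num).biUnion R.path ∪
      (Finset.Icc 1 F.card).image fun v => arcTo v₀ (0, v)) ∪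
      (Finset.range (Q + 1)).biUnion fun q => (B q).image (arcTo v₀) := by
    intro e he
    rcases hacc.edges e he with ⟨j, hj, he⟩ | ⟨p, v, hv, hvM, rfl, hp⟩
    · exact Finset.mem_union_left _ (Finset.mem_union_left _
        (Finset.mem_biUnion.2 ⟨j, Finset.mem_range.2 hj, he⟩))
    · rcases Nat.eq_zero_or_pos p with rfl | hp0
      · exact Finset.mem_union_left _ (Finset.mem_union_right _
          (Finset.mem_image.2 ⟨v, Finset.mem_Icc.2 ⟨hv, hvM⟩, rfl⟩))
      · obtain ⟨q, hq⟩ := hp.resolve_left (by omega)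
        have hqQ : q ∈ Finset.range (Q + 1) := by
          obtain ⟨i, ⟨k, hk, -⟩, -⟩ := hq
          obtain ⟨hkN, rfl⟩ := Finset.mem_filter.1 hk
          exact hphase k (Finset.mem_range.1 hkN)
        exact Finset.mem_union_right _ (Finset.mem_biUnion.2 ⟨q, hqQ,
          Finset.mem_image.2 ⟨(p, v), hBmem q p v hp0 hq, rfl⟩⟩)
  have hpaths : ((Finset.range R.num).biUnion R.path).card ≤
      ∑ q ∈ Finset.range (Q + 1), 52 * delta q * F.card := by
    refine Finset.card_biUnion_le.trans ?_
    rw [← Finset.sum_fiberwise_of_maps_to (g := phase n) (t := Finset.range (Q + 1))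
      (fun k hk => hphase k (Finset.mem_range.1 hk))]
    refine Finset.sum_le_sum fun q _ => ?_
    refine le_trans (Finset.sum_le_sum fun k hk => ?_) (sum_source_le (n := n) R.reqTime_mono
      R.req_inj hcov hX (fun k hk => by have := hcard k hk; omega) q)
    obtain ⟨hk', rfl⟩ := Finset.mem_filter.1 hk
    have h1 := reqPos_lt (Finset.mem_range.1 hk')
    have h2 := R.src_le k
    refine (card_horizontalPath_le _ _ _).trans ?_
    rw [node_val (by omega), node_val (by omega), Nat.add_sub_add_left]
    exact le_rfl
  have hkept : ((Finset.range (Q + 1)).biUnion fun q => (B q).image (arcTo v₀)).card ≤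
      ∑ q ∈ Finset.range (Q + 1), 410 * delta q * F.card :=
    Finset.card_biUnion_le.trans (Finset.sum_le_sum fun q _ => Finset.card_image_le.trans (hB q))
  have horigin : ((Finset.Icc 1 F.card).image fun v => arcTo v₀ (0, v)).card ≤ F.card :=
    Finset.card_image_le.trans (by simp)
  have hsum := sum_delta_le Q
  have h16 := sixteen_le_delta Q
  have h1 := (Finset.card_le_card hsub).trans (Finset.card_union_le _ _)
  have h2 := Finset.card_union_le ((Finset.range R.num).biUnion R.path)
    ((Finset.Icc 1 F.card).image fun v => arcTo v₀ (0, v))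
  rw [← Finset.sum_mul, ← Finset.mul_sum] at hpaths hkept
  rw [← hF]
  show (memory R.events).sol.card ≤ _
  nlinarith [Nat.mul_le_mul_right F.card hsum, Nat.mul_le_mul_right F.card h16]

end DMCD

/-! ### Logarithmic estimates -/

namespace DMCD

lemma log_three_gt : 1.09 < Real.log 3 := by
  have h1 : Real.log (3 / Real.exp 1) = Real.log 3 - 1 := by
    rw [Real.log_div (by norm_num) (Real.exp_pos 1).ne', Real.log_exp]
  have h2 := Real.one_sub_inv_le_log_of_pos (x := 3 / Real.exp 1) (by positivity)
  rw [h1, inv_div] at h2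
  have := Real.exp_one_lt_d9
  linarith

lemma log_ge_of_three_le {x : ℕ} (hx : 3 ≤ x) : 1.09 < Real.log x :=
  log_three_gt.trans_le (Real.log_le_log (by norm_num) (by exact_mod_cast hx))

lemma one_le_logRatio {x : ℕ} (hx : 3 ≤ x) : 1 ≤ logRatio x := by
  have h := log_ge_of_three_le hx
  have h1 : 0 < Real.log (Real.log x) := Real.log_pos (by linarith)
  have h2 := Real.log_le_sub_one_of_pos (by linarith : 0 < Real.log x)
  unfold logRatio
  rw [le_div_iff₀ h1]
  linarith

/-- The solution of `e ^ e = x` is at most `2 log x / log log x`. -/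
lemma le_two_mul_logRatio {e x : ℕ} (he : 16 ≤ e) (hx : e ^ e ≤ x) : (e : ℝ) ≤ 2 * logRatio x := by
  have h16 : (16 : ℝ) ≤ e := by exact_mod_cast he
  have hxe : e ≤ x := (Nat.le_self_pow (by omega) e).trans hx
  have h := log_ge_of_three_le (by omega : 3 ≤ x)
  have h1 : 0 < Real.log (Real.log x) := Real.log_pos (by linarith)
  have h2 : e * Real.log e ≤ Real.log x := by
    rw [← Real.log_pow]
    exact Real.log_le_log (by positivity) (by exact_mod_cast hx)
  -- With `log x = e z` we have `log e ≤ z`, so that `log (log x) = log e + log z ≤ 2 z`.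
  obtain ⟨z, hz⟩ : ∃ z, Real.log x = e * z := ⟨Real.log x / e, by field_simp⟩
  rw [hz] at h2
  have h3 : Real.log e ≤ z := le_of_mul_le_mul_left h2 (by linarith)
  have hz0 : 0 < z := (Real.log_pos (by linarith)).trans_le h3
  have h4 := Real.log_le_sub_one_of_pos hz0
  have h5 : Real.log (Real.log x) = Real.log e + Real.log z := by
    rw [hz, Real.log_mul (by linarith) hz0.ne']
  unfold logRatio
  rw [← mul_div_assoc, le_div_iff₀ h1, h5, hz]
  nlinarith

/-- A phase is reached only if both the number of requests and `n` have exceeded `e ^ e` for the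
previous guess `e`, which is half of the present one. -/
lemma delta_phase_le {n N : ℕ} (hn : 3 ≤ n) (hN : 3 ≤ N) :
    (delta (phase n (N - 1)) : ℝ) ≤ 16 * min (logRatio N) (logRatio n) := by
  rcases h : phase n (N - 1) with _ | q
  · have := le_min (one_le_logRatio hN) (one_le_logRatio hn)
    simp only [delta, pow_zero, mul_one, Nat.cast_ofNat]
    linarith
  · obtain ⟨h1, h2⟩ := of_lt_phase (by omega : q < phase n (N - 1))
    have h3 := le_two_mul_logRatio (sixteen_le_delta q) (h1.trans (Nat.sub_le _ _))
    have h4 := le_two_mul_logRatio (sixteen_le_delta q) h2.le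
    have h5 : (delta q : ℝ) / 2 ≤ min (logRatio N) (logRatio n) :=
      le_min (by linarith) (by linarith)
    rw [delta_succ]
    push_cast
    have : (0 : ℝ) ≤ delta q := by positivity
    linarith

theorem exists_competitive : ∃ D : (n : ℕ) → (v₀ : Fin n) → OnlineAlg v₀, ∃ C : ℝ, 0 < C ∧
      ∀ (n : ℕ) (v₀ : Fin n) (R : Requests v₀), 3 ≤ n → 3 ≤ R.num →
        (((D n v₀).cost R : ℕ) : ℝ) ≤
          C * min (logRatio R.num) (logRatio n) * (opt R : ℝ) := by
  refine ⟨scaleAlg, 14800, by norm_num, fun n v₀ R hn hN => ?_⟩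
  have h1 : (((scaleAlg n v₀).cost R : ℕ) : ℝ) ≤
      925 * (delta (phase n (R.num - 1)) : ℝ) * (opt R : ℝ) := by
    exact_mod_cast cost_scaleAlg_le R
  refine h1.trans (mul_le_mul_of_nonneg_right ?_ (Nat.cast_nonneg _))
  have := delta_phase_le hn hN
  linarith

/-- The number of levels of the adversary is about `log m / (8 log log m)`, unless this is small. -/
lemma exists_levels {m : ℕ} (hm : 3 ≤ m) :
    logRatio m ≤ 128 ∨ ∃ k : ℕ, 1 ≤ k ∧ 2 * (4 * k ^ 2) ^ k < m ∧ logRatio m ≤ 16 * k := by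
  have h := log_ge_of_three_le hm
  have hpos : 0 < Real.log (Real.log m) := Real.log_pos (by linarith)
  set y := Real.log m with hy
  by_cases hlog : Real.log y < 1
  · left
    have h1 : y < 2.7182818286 := by
      have h2 := (Real.log_lt_iff_lt_exp (by linarith)).1 hlog
      exact h2.trans Real.exp_one_lt_d9
    have h3 := Real.one_sub_inv_le_log_of_pos (by linarith : 0 < y)
    have h4 : y * y⁻¹ = 1 := mul_inv_cancel₀ (by linarith)
    unfold logRatio
    rw [← hy, div_le_iff₀ hpos]
    nlinarith
  by_cases hx : logRatio m ≤ 128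
  · exact Or.inl hx
  right
  have hxy : logRatio m * Real.log y = y := div_mul_cancel₀ _ hpos.ne'
  set x := logRatio m
  have hk1 := Nat.floor_le (a := x / 8) (by linarith)
  have hk2 := Nat.lt_floor_add_one (x / 8)
  set k := ⌊x / 8⌋₊
  have hk16 : (15 : ℝ) ≤ k := by linarith
  have hky : 8 * k * Real.log y ≤ y := by nlinarith
  have hk8 : 8 * (k : ℝ) ≤ y := by nlinarith
  have hlogk : Real.log k ≤ Real.log y := Real.log_le_log (by linarith) (by linarith)
  have h4 : Real.log 4 ≤ 3 := (Real.log_le_sub_one_of_pos (by norm_num)).trans (by norm_num)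
  have h2 : Real.log 2 ≤ 1 := (Real.log_le_sub_one_of_pos (by norm_num)).trans (by norm_num)
  refine ⟨k, by exact_mod_cast (by linarith : (1 : ℝ) ≤ k), ?_, by linarith⟩
  have hk0 : (0 : ℝ) < k := by linarith
  have h5 : Real.log (2 * (4 * (k : ℝ) ^ 2) ^ k) =
      Real.log 2 + k * (Real.log 4 + 2 * Real.log k) := by
    rw [Real.log_mul (by norm_num) (by positivity), Real.log_pow,
      Real.log_mul (by norm_num) (by positivity), Real.log_pow]
    norm_num
  have h6 : Real.log (2 * (4 * (k : ℝ) ^ 2) ^ k) < Real.log m := by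
    rw [h5, ← hy]
    have h7 : k * Real.log k ≤ k * Real.log y := mul_le_mul_of_nonneg_left hlogk hk0.le
    nlinarith
  have h7 := (Real.log_lt_log_iff (by positivity) (by
    have : 0 < m := by omega
    exact_mod_cast this)).1 h6
  exact_mod_cast h7

end DMCD

/-! ### The scales of the adversary -/

namespace DMCD

/-- The length scale of level `l`, for an adversary with `k` levels. -/
def scale (k l : ℕ) : ℕ := (4 * k ^ 2) ^ l

/-- The length in time of a period of level `l`. -/
def period (k l : ℕ) : ℕ := k * scale k l

/-- How far the moves of level `l` go up to time `t`, apart from the one at time `0`: at the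
beginning of each of its periods, level `l` moves by its scale. -/
def drift (k l t : ℕ) : ℕ := scale k l * (t / period k l)

/-- The position that all levels have reached at time `t`. -/
def front (k t : ℕ) : ℕ := ∑ j ∈ Finset.range k, (drift k j t + scale k j)

/-- The base of level `l` at time `t`: the position reached at the beginning of its current
period, after the moves of the levels above `l` and before those of `l` and the levels below. At
this moment the levels up to `l` have all drifted equally far. -/
def base (k l t : ℕ) : ℕ :=
  ∑ j ∈ Finset.Ico (l + 1) k, (drift k j t + scale k j) + (l + 1) * drift k l t

variable {k : ℕ}

lemma scale_pos (hk : 1 ≤ k) (l : ℕ) : 0 < scale k l := pow_pos (by positivity) l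

lemma period_pos (hk : 1 ≤ k) (l : ℕ) : 0 < period k l := Nat.mul_pos hk (scale_pos hk l)

lemma scale_succ (l : ℕ) : scale k (l + 1) = 4 * k ^ 2 * scale k l := by
  unfold scale; rw [pow_succ, mul_comm]

lemma scale_dvd {l l' : ℕ} (h : l ≤ l') : scale k l ∣ scale k l' := pow_dvd_pow _ h

lemma period_dvd {l l' : ℕ} (h : l ≤ l') : period k l ∣ period k l' :=
  mul_dvd_mul_left _ (scale_dvd h)

lemma drift_mono (l : ℕ) {t t' : ℕ} (h : t ≤ t') : drift k l t ≤ drift k l t' :=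
  Nat.mul_le_mul_left _ (Nat.div_le_div_right h)

lemma front_mono {t t' : ℕ} (h : t ≤ t') : front k t ≤ front k t' :=
  Finset.sum_le_sum fun j _ => Nat.add_le_add_right (drift_mono j h) _

lemma drift_succ_le (hk : 1 ≤ k) (l t : ℕ) : drift k (l + 1) t ≤ drift k l t := by
  obtain ⟨r, hr⟩ := scale_dvd (k := k) (Nat.le_succ l)
  have hpos := period_pos hk l
  unfold drift
  have h1 : period k (l + 1) = period k l * r := by unfold period; rw [hr, mul_assoc]
  rw [h1, hr, mul_assoc, ← Nat.div_div_eq_div_mul]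
  exact Nat.mul_le_mul_left _ (Nat.mul_div_le _ _)

lemma base_succ_add_le (hk : 1 ≤ k) {l : ℕ} (hl : l + 1 < k) (t : ℕ) :
    base k (l + 1) t + scale k (l + 1) ≤ base k l t := by
  have := drift_succ_le hk l t
  unfold base
  rw [Finset.sum_eq_sum_Ico_succ_bot hl]
  nlinarith

/-- The windows of length `3 * k * period k l` to the left of the bases are disjoint. -/
lemma base_add_lt (hk : 1 ≤ k) {l l' : ℕ} (hl : l < l') (hl' : l' < k) (t : ℕ) :
    base k l' t + 3 * k * period k l < base k l t := by
  have h1 : base k l' t ≤ base k (l + 1) t := by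
    induction l', hl using Nat.le_induction with
    | base => exact le_rfl
    | succ l' _ ih =>
      have := base_succ_add_le hk hl' t
      have := ih (by omega)
      omega
  have h2 := base_succ_add_le hk (by omega : l + 1 < k) t
  have h3 := scale_succ (k := k) l
  have h4 := scale_pos hk l
  have h5 : 3 * k * period k l = 3 * k ^ 2 * scale k l := by unfold period; ring
  have h6 : 0 < k ^ 2 * scale k l := by positivity
  nlinarith

lemma scale_sum_le (hk : 1 ≤ k) (m : ℕ) : ∑ j ∈ Finset.range m, scale k j ≤ scale k m := by
  induction m with
  | zero => simp
  | succ m ih =>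
    rw [Finset.sum_range_succ, scale_succ]
    have : 1 ≤ k ^ 2 := Nat.one_le_pow _ _ hk
    nlinarith

/-- Each level drifts by at most `t / k` up to time `t`. -/
lemma front_le (hk : 1 ≤ k) (t : ℕ) : front k t ≤ t + scale k k := by
  unfold front
  rw [Finset.sum_add_distrib]
  refine Nat.add_le_add ?_ (scale_sum_le hk k)
  refine Nat.le_of_mul_le_mul_left ?_ hk
  rw [Finset.mul_sum]
  refine (Finset.sum_le_card_nsmul _ _ t fun j _ => ?_).trans (by simp)
  unfold drift
  rw [← mul_assoc]
  exact Nat.mul_div_le t (period k j)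

/-- The first time of the period of level `l` that contains `t`. -/
def periodStart (k l t : ℕ) : ℕ := period k l * (t / period k l)

lemma periodStart_le (l t : ℕ) : periodStart k l t ≤ t := Nat.mul_div_le _ _

lemma le_periodStart_add (hk : 1 ≤ k) (l t : ℕ) : t ≤ periodStart k l t + period k l := by
  have := Nat.lt_mul_div_succ t (period_pos hk l)
  unfold periodStart
  rw [mul_add] at this
  omega

lemma periodStart_div {l j : ℕ} (hk : 1 ≤ k) (h : l ≤ j) (t : ℕ) :
    periodStart k l t / period k j = t / period k j := by
  obtain ⟨r, hr⟩ := period_dvd (k := k) h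
  unfold periodStart
  rw [hr, Nat.mul_div_mul_left _ _ (period_pos hk l), Nat.div_div_eq_div_mul]

/-- The beginning of a period of level `l` is a multiple of the periods of the lower levels, which
have then drifted as far as level `l`. -/
lemma scale_mul_periodStart (l t : ℕ) {j : ℕ} (h : j ≤ l) :
    ∃ r, periodStart k l t = period k j * r ∧ drift k l t = scale k j * r := by
  obtain ⟨r, hr⟩ := scale_dvd (k := k) h
  refine ⟨r * (t / period k l), ?_, ?_⟩
  · unfold periodStart; rw [← mul_assoc]; congr 1; unfold period; rw [hr, mul_assoc]
  · unfold drift; rw [hr, mul_assoc]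

lemma sum_const_eq (l c : ℕ) : (l + 1) * c = ∑ _j ∈ Finset.range (l + 1), c := by simp

lemma front_eq {l : ℕ} (hl : l < k) (t : ℕ) : front k t =
    ∑ j ∈ Finset.Ico (l + 1) k, (drift k j t + scale k j) +
      ∑ j ∈ Finset.range (l + 1), (drift k j t + scale k j) := by
  unfold front
  rw [Finset.range_eq_Ico, Finset.range_eq_Ico, add_comm,
    Finset.sum_Ico_consecutive _ (Nat.zero_le _) hl]

/-- Together with `front_pred_le_base`: the front sweeps over the base of level `l` at the beginning
of the period. -/
lemma base_le_front (hk : 1 ≤ k) {l : ℕ} (hl : l < k) (t : ℕ) :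
    base k l t ≤ front k (periodStart k l t) := by
  rw [front_eq hl]
  unfold base
  rw [sum_const_eq]
  refine Nat.add_le_add (Finset.sum_le_sum fun j hj => ?_) (Finset.sum_le_sum fun j hj => ?_)
  · have h1 := (Finset.mem_Ico.1 hj).1
    unfold drift
    rw [periodStart_div hk (by omega)]
  · obtain ⟨r, h1, h2⟩ := scale_mul_periodStart (k := k) l t
      (Nat.lt_succ_iff.1 (Finset.mem_range.1 hj))
    rw [h2]
    unfold drift
    rw [h1, Nat.mul_div_cancel_left _ (period_pos hk j)]
    omega

lemma front_pred_le_base (hk : 1 ≤ k) {l : ℕ} (hl : l < k) (t : ℕ)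
    (hs : 0 < periodStart k l t) : front k (periodStart k l t - 1) ≤ base k l t := by
  rw [front_eq hl]
  unfold base
  rw [sum_const_eq]
  refine Nat.add_le_add (Finset.sum_le_sum fun j hj => ?_) (Finset.sum_le_sum fun j hj => ?_)
  · have := periodStart_le (k := k) l t
    exact Nat.add_le_add_right (drift_mono j (by omega)) _
  · obtain ⟨r, h1, h2⟩ := scale_mul_periodStart (k := k) l t
      (Nat.lt_succ_iff.1 (Finset.mem_range.1 hj))
    rw [h2]
    unfold drift
    have h3 : (periodStart k l t - 1) / period k j < r := by
      rw [Nat.div_lt_iff_lt_mul (period_pos hk j), mul_comm, ← h1]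
      omega
    calc _ = scale k j * ((periodStart k l t - 1) / period k j + 1) := by ring
      _ ≤ _ := Nat.mul_le_mul_left _ h3

lemma base_le_front_self (hk : 1 ≤ k) {l : ℕ} (hl : l < k) (t : ℕ) : base k l t ≤ front k t :=
  (base_le_front hk hl t).trans (front_mono (periodStart_le l t))

end DMCD

/-! ### The adversary -/

namespace DMCD

variable {n : ℕ} {v₀ : Fin n}

lemma OnlineAlg.subset_append (A : OnlineAlg v₀) (h h' : List (Event v₀)) :
    A.sol h ⊆ A.sol (h ++ h') := by
  induction h' using List.reverseRecOn with
  | nil => simp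
  | append_singleton h' e ih =>
    rw [← List.append_assoc]
    refine ih.trans ?_
    cases e with
    | request v =>
      obtain ⟨u, -, -, hu⟩ := A.sol_request (h ++ h') v
      rw [hu]
      exact Finset.subset_union_left
    | tick =>
      obtain ⟨S, -, -, hS⟩ := A.sol_tick (h ++ h')
      rw [hS]
      exact Finset.subset_union_left

lemma OnlineAlg.time_le (A : OnlineAlg v₀) (h : List (Event v₀)) :
    ∀ e ∈ A.sol h, e.1.2 ≤ e.2.2 ∧ e.2.2 ≤ clock h := by
  induction h using List.reverseRecOn with
  | nil => simp [A.sol_nil]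
  | append_singleton h e ih =>
    intro e' he'
    rw [clock_append]
    cases e with
    | request v =>
      obtain ⟨u, -, -, hu⟩ := A.sol_request h v
      rw [hu] at he'
      rcases Finset.mem_union.1 he' with he' | he'
      · have := ih e' he'; omega
      · obtain ⟨p, -, rfl⟩ := Finset.mem_image.1 he'
        simp
    | tick =>
      obtain ⟨S, -, -, hS⟩ := A.sol_tick h
      rw [hS] at he'
      rcases Finset.mem_union.1 he' with he' | he'
      · have := ih e' he'; omega
      · obtain ⟨p, -, rfl⟩ := Finset.mem_image.1 he'
        simp [clock]

/-- After a time event, the copies at the current time are the heads of the stored arcs. -/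
lemma OnlineAlg.exists_arc (A : OnlineAlg v₀) {h : List (Event v₀)} {w : Fin n}
    (hw : HasCopy v₀ (A.sol (h ++ [Event.tick])) w (clock h + 1)) :
    ∃ e ∈ A.sol (h ++ [Event.tick]), e.2 = (w, clock h + 1) := by
  rcases hw with hw | ⟨e, he, hw | hw⟩
  · simp at hw
  · exfalso
    obtain ⟨S, -, -, hS⟩ := A.sol_tick h
    rw [hS] at he
    rcases Finset.mem_union.1 he with he | he
    · have := A.time_le h e he
      rw [hw] at this
      simp only at this
      omega
    · obtain ⟨p, -, rfl⟩ := Finset.mem_image.1 he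
      simp at hw
  · exact ⟨e, he, hw⟩

lemma le_card_horizontalPath (u v : Fin n) (t : ℕ) :
    (v : ℕ) - u ≤ (horizontalPath u v t).card := by
  have hv := v.2
  rw [← Nat.card_Ico, ← Fintype.card_coe]
  refine (Fintype.card_le_of_injective (β := horizontalPath u v t) (fun i => ⟨((⟨i.1, ?_⟩, t),
    (⟨i.1 + 1, ?_⟩, t)), Finset.mem_image.2 ⟨(_, _),
      Finset.mem_filter.2 ⟨Finset.mem_univ _, ?_, rfl, ?_⟩, rfl⟩⟩) ?_).trans_eq (Fintype.card_coe _)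
  · have := Finset.mem_Ico.1 i.2; omega
  · have := Finset.mem_Ico.1 i.2; omega
  · exact (Finset.mem_Ico.1 i.2).1
  · exact Nat.succ_le_of_lt (Finset.mem_Ico.1 i.2).2
  · intro i j hij
    exact Subtype.ext (congrArg (fun e => (e.1.1.1 : ℕ)) hij)

lemma le_node (p : ℕ) : v₀ ≤ node v₀ p := by
  show (v₀ : ℕ) ≤ node v₀ p
  unfold node
  split_ifs
  · exact Nat.le_add_right _ _
  · exact le_rfl

/-- The node at distance `p` from the origin, as a possible request. -/
def target (v₀ : Fin n) (p : ℕ) : Set.Ici v₀ := ⟨node v₀ p, le_node p⟩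

/-- The solution `F` has no replica at time `t` in the window of level `l`. -/
def Misses (v₀ : Fin n) (F : Finset (DirPair n)) (k t l : ℕ) : Prop :=
  ∀ w : Fin n, HasCopy v₀ F w t → (w : ℕ) ≤ base k l t → (w : ℕ) + 3 * k * period k l < base k l t

open Classical in
/-- A level whose window is missed at time `t` after the history `h`, if there is one. -/
noncomputable def attack (A : OnlineAlg v₀) (k : ℕ) (h : List (Event v₀)) (t : ℕ) : Option ℕ :=
  if H : ∃ l < k, Misses v₀ (A.sol h) k t l then some H.choose else none

lemma attack_some {A : OnlineAlg v₀} {k : ℕ} {h : List (Event v₀)} {t l : ℕ}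
    (H : attack A k h t = some l) : l < k ∧ Misses v₀ (A.sol h) k t l := by
  unfold attack at H
  split_ifs at H with H'
  rw [← Option.some.inj H]
  exact H'.choose_spec

lemma attack_none {A : OnlineAlg v₀} {k : ℕ} {h : List (Event v₀)} {t : ℕ}
    (H : attack A k h t = none) : ∀ l < k, ¬ Misses v₀ (A.sol h) k t l := by
  unfold attack at H
  split_ifs at H with H'
  push Not at H'
  exact H'

/-- The history and the requests up to time `t`: after each time event the base of a level is
requested whose window is missed, if there is one. -/
noncomputable def play (A : OnlineAlg v₀) (k : ℕ) :
    ℕ → List (Event v₀) × List (Set.Ici v₀ × ℕ)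
  | 0 => ([], [])
  | t + 1 => match attack A k ((play A k t).1 ++ [Event.tick]) (t + 1) with
    | none => ((play A k t).1 ++ [Event.tick], (play A k t).2)
    | some l => ((play A k t).1 ++ [Event.tick] ++ [Event.request (target v₀ (base k l (t + 1)))],
        (play A k t).2 ++ [(target v₀ (base k l (t + 1)), t + 1)])

/-- The level attacked at time `t + 1`. -/
noncomputable def attacked (A : OnlineAlg v₀) (k t : ℕ) : Option ℕ :=
  attack A k ((play A k t).1 ++ [Event.tick]) (t + 1)

variable {A : OnlineAlg v₀} {k : ℕ}

lemma play_none {t : ℕ} (h : attacked A k t = none) : play A k (t + 1) =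
    ((play A k t).1 ++ [Event.tick], (play A k t).2) := by
  unfold attacked at h
  simp only [play]
  rw [h]

lemma play_some {t l : ℕ} (h : attacked A k t = some l) : play A k (t + 1) =
    ((play A k t).1 ++ [Event.tick] ++ [Event.request (target v₀ (base k l (t + 1)))],
        (play A k t).2 ++ [(target v₀ (base k l (t + 1)), t + 1)]) := by
  unfold attacked at h
  simp only [play]
  rw [h]

lemma clock_play (t : ℕ) : clock (play A k t).1 = t := by
  induction t with
  | zero => rfl
  | succ t ih =>
    rcases h : attacked A k t with _ | l
    · rw [play_none h, clock_append, ih]; rfl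
    · rw [play_some h, clock_append, clock_append, ih]; rfl

lemma eventsFrom_tick {t : ℕ} {r : Set.Ici v₀ × ℕ} (l : List (Set.Ici v₀ × ℕ)) (h : t + 1 ≤ r.2) :
    eventsFrom t (r :: l) = Event.tick :: eventsFrom (t + 1) (r :: l) := by
  have : r.2 - t = (r.2 - (t + 1)) + 1 := by omega
  simp only [eventsFrom]
  rw [this, List.replicate_succ, List.cons_append]

/-- The history is the sequence of events of the requests. -/
lemma eventsFrom_play (t : ℕ) (r : Set.Ici v₀ × ℕ) (l : List (Set.Ici v₀ × ℕ)) (hr : t ≤ r.2) :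
    eventsFrom 0 ((play A k t).2 ++ r :: l) = (play A k t).1 ++ eventsFrom t (r :: l) := by
  induction t generalizing r l with
  | zero => rfl
  | succ t ih =>
    rcases h : attacked A k t with _ | i
    · rw [play_none h, ih r l (by omega), eventsFrom_tick l hr]
      simp
    · rw [play_some h]
      simp only [List.append_assoc, List.singleton_append]
      rw [ih _ _ (by simp), eventsFrom_tick _ le_rfl]
      simp [eventsFrom]

lemma mem_play {t : ℕ} {r : Set.Ici v₀ × ℕ} (hr : r ∈ (play A k t).2) :
    ∃ j < t, ∃ l, attacked A k j = some l ∧ r = (target v₀ (base k l (j + 1)), j + 1) := by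
  induction t with
  | zero => simp [play] at hr
  | succ t ih =>
    rcases h : attacked A k t with _ | l
    · rw [play_none h] at hr
      obtain ⟨j, hj, h'⟩ := ih hr
      exact ⟨j, by omega, h'⟩
    · rw [play_some h] at hr
      rcases List.mem_append.1 hr with hr | hr
      · obtain ⟨j, hj, h'⟩ := ih hr
        exact ⟨j, by omega, h'⟩
      · exact ⟨t, by omega, l, h, List.mem_singleton.1 hr⟩

lemma play_pairwise (t : ℕ) : (play A k t).2.Pairwise (fun r s => r.2 < s.2) := by
  induction t with
  | zero => exact List.Pairwise.nil
  | succ t ih =>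
    rcases h : attacked A k t with _ | l
    · rw [play_none h]; exact ih
    · rw [play_some h]
      refine List.pairwise_append.2 ⟨ih, List.pairwise_singleton _ _, fun r hr s hs => ?_⟩
      obtain ⟨j, hj, -, -, rfl⟩ := mem_play hr
      rw [List.mem_singleton.1 hs]
      simpa using hj

lemma play_length (t : ℕ) : (play A k t).2.length ≤ t := by
  induction t with
  | zero => simp [play]
  | succ t ih =>
    rcases h : attacked A k t with _ | l
    · rw [play_none h]; exact ih.trans (Nat.le_succ _)
    · rw [play_some h]; simp [ih]

lemma play_subset {t t' : ℕ} (h : t ≤ t') : A.sol (play A k t).1 ⊆ A.sol (play A k t').1 := by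
  induction t', h using Nat.le_induction with
  | base => exact Finset.Subset.refl _
  | succ t' _ ih =>
    refine ih.trans ?_
    rcases h : attacked A k t' with _ | l
    · rw [play_none h]; exact A.subset_append _ _
    · rw [play_some h]; exact (A.subset_append _ _).trans (A.subset_append _ _)

/-- The requests of the adversary: the play up to time `m`, and the front at time `m + 1`. -/
noncomputable def attackRequests (A : OnlineAlg v₀) (k m : ℕ) : Requests v₀ where
  list := (play A k m).2 ++ [(target v₀ (front k (m + 1)), m + 1)]
  nodup := by
    have : ((play A k m).2 ++ [(target v₀ (front k (m + 1)), m + 1)]).Pairwise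
        (fun r s => r.2 < s.2) := by
      refine List.pairwise_append.2 ⟨play_pairwise m, List.pairwise_singleton _ _,
        fun r hr s hs => ?_⟩
      obtain ⟨j, hj, -, -, rfl⟩ := mem_play hr
      rw [List.mem_singleton.1 hs]
      simpa using hj
    exact this.imp fun {r s} h heq => by rw [heq] at h; exact lt_irrefl _ h
  sorted := by
    refine List.pairwise_append.2 ⟨(play_pairwise m).imp fun h => h.le,
      List.pairwise_singleton _ _, fun r hr s hs => ?_⟩
    obtain ⟨j, hj, -, -, rfl⟩ := mem_play hr
    rw [List.mem_singleton.1 hs]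
    show j + 1 ≤ m + 1
    omega

lemma attackRequests_num_le (m : ℕ) : (attackRequests A k m).num ≤ m + 1 := by
  have := play_length (A := A) (k := k) m
  simp only [Requests.num, attackRequests, List.length_append, List.length_singleton]
  omega

lemma play_subset_final (m : ℕ) :
    A.sol (play A k m).1 ⊆ A.sol (attackRequests A k m).events := by
  unfold Requests.events attackRequests
  simp only
  rw [eventsFrom_play m _ [] (by simp)]
  exact A.subset_append _ _

/-- The amount by which an attack on a level raises the optimal cost. -/
def pay (k : ℕ) (o : Option ℕ) : ℕ := o.elim 0 (period k)

open Classical in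
/-- The algorithm pays at every time for a copy in each window, or for a missed window. -/
lemma le_card_slice (hk : 1 ≤ k) (hv₀ : (v₀ : ℕ) = 0) (t : ℕ) (hn : front k (t + 1) < n) :
    k + 2 * k * pay k (attacked A k t) ≤
      ((A.sol (play A k (t + 1)).1).filter fun e => e.2.2 = t + 1).card := by
  set h := (play A k t).1 with hh
  have hclock : clock h = t := clock_play t
  rcases hl : attacked A k t with _ | l
  · rw [play_none hl]
    have hmiss := attack_none hl
    have : Nonempty (Fin n) := ⟨v₀⟩
    unfold Misses at hmiss
    push Not at hmiss
    choose! w hw1 hw2 hw3 using hmiss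
    have harc : ∀ l < k, ∃ e ∈ A.sol (h ++ [Event.tick]), e.2 = (w l, t + 1) := fun l hl => by
      have hw : HasCopy v₀ (A.sol (h ++ [Event.tick])) (w l) (clock h + 1) := by
        rw [hclock]; exact hw1 l hl
      obtain ⟨e, he, he'⟩ := A.exists_arc hw
      exact ⟨e, he, by rw [he', hclock]⟩
    choose! e he1 he2 using harc
    -- The windows are disjoint, so the arcs into them are distinct.
    have hcard : (Finset.range k).card ≤
        ((A.sol (h ++ [Event.tick])).filter fun e => e.2.2 = t + 1).card := by
      refine Finset.card_le_card_of_injOn e ?_ ?_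
      · intro l hl
        have hl' := Finset.mem_range.1 (Finset.mem_coe.1 hl)
        exact Finset.mem_coe.2 (Finset.mem_filter.2 ⟨he1 l hl', by rw [he2 l hl']⟩)
      · have key : ∀ l l', l < l' → l' < k → e l ≠ e l' := by
          intro l l' hll hl' heq
          have h1 := he2 l (by omega)
          rw [heq, he2 l' hl'] at h1
          have h2 : w l' = w l := congrArg Prod.fst h1
          have h3 := base_add_lt hk hll hl' (t + 1)
          have h4 := hw2 l' hl'
          have h5 := hw3 l (by omega)
          rw [h2] at h4
          omega
        intro l hl l' hl' heq
        have h1 := Finset.mem_range.1 (Finset.mem_coe.1 hl)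
        have h2 := Finset.mem_range.1 (Finset.mem_coe.1 hl')
        rcases lt_trichotomy l l' with hlt | h3 | hlt
        · exact (key l l' hlt h2 heq).elim
        · exact h3
        · exact (key l' l hlt h1 heq.symm).elim
    simpa [pay] using hcard
  · rw [play_some hl]
    obtain ⟨hlk, hmiss⟩ := attack_some hl
    obtain ⟨u, hu1, hu2, hu3⟩ := A.sol_request (h ++ [Event.tick]) (target v₀ (base k l (t + 1)))
    have hc : clock (h ++ [Event.tick]) = t + 1 := by rw [clock_append, hclock]; rfl
    rw [hc] at hu2 hu3
    have hb := base_le_front_self hk hlk (t + 1)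
    have hval : ((target v₀ (base k l (t + 1))).1 : ℕ) = base k l (t + 1) := by
      show (node v₀ _ : ℕ) = _
      rw [node_val (by omega)]
      omega
    have hu1' : (u : ℕ) ≤ (target v₀ (base k l (t + 1))).1 := hu1
    rw [hval] at hu1'
    have hgap := hmiss u hu2 hu1'
    have hsub : horizontalPath u (target v₀ (base k l (t + 1))).1 (t + 1) ⊆
        (A.sol (h ++ [Event.tick] ++ [Event.request (target v₀ (base k l (t + 1)))])).filter
          fun e => e.2.2 = t + 1 := by
      intro e he
      refine Finset.mem_filter.2 ⟨by rw [hu3]; exact Finset.mem_union_right _ he, ?_⟩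
      obtain ⟨p, -, rfl⟩ := Finset.mem_image.1 he
      rfl
    refine le_trans ?_ ((le_card_horizontalPath _ _ _).trans (Finset.card_le_card hsub))
    rw [hval]
    have := period_pos hk l
    show k + 2 * k * period k l ≤ _
    have h3 : 3 * k * period k l = 2 * k * period k l + k * period k l := by ring
    have h4 : k ≤ k * period k l := Nat.le_mul_of_pos_right k this
    omega

open Classical in
/-- The edges with heads at different times are different. -/
lemma sum_pay_le_cost (hk : 1 ≤ k) (hv₀ : (v₀ : ℕ) = 0) (m : ℕ) (hn : front k (m + 1) < n) :
    ∑ t ∈ Finset.range m, (k + 2 * k * pay k (attacked A k t)) ≤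
      A.cost (attackRequests A k m) := by
  refine le_trans ?_ (Finset.card_le_card (play_subset_final (A := A) (k := k) m))
  calc _ ≤ ∑ t ∈ Finset.range m,
        ((A.sol (play A k m).1).filter fun e => e.2.2 = t + 1).card :=
        Finset.sum_le_sum fun t ht => by
          have ht' := Finset.mem_range.1 ht
          have hf := front_mono (k := k) (by omega : t + 1 ≤ m + 1)
          exact (le_card_slice hk hv₀ t (by omega)).trans (Finset.card_le_card
            (Finset.filter_subset_filter _ (play_subset (by omega))))
    _ = ((Finset.range m).biUnion fun t =>
        (A.sol (play A k m).1).filter fun e => e.2.2 = t + 1).card := by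
        rw [Finset.card_biUnion]
        intro t _ t' _ hne
        rw [Function.onFun, Finset.disjoint_left]
        intro e he he'
        have h1 := (Finset.mem_filter.1 he).2
        have h2 := (Finset.mem_filter.1 he').2
        omega
    _ ≤ _ := Finset.card_le_card (Finset.biUnion_subset.2 fun t _ => Finset.filter_subset _ _)

/-! ### An offline solution -/

/-- The path along the front, up to time `T`. -/
noncomputable def frontPath (v₀ : Fin n) (k : ℕ) : ℕ → Finset (DirPair n)
  | 0 => horizontalPath v₀ (node v₀ (front k 0)) 0
  | T + 1 => frontPath v₀ k T ∪ (storageArcs {node v₀ (front k T)} T ∪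
      horizontalPath (node v₀ (front k T)) (node v₀ (front k (T + 1))) (T + 1))

lemma storageArcs_subset_edges (S : Finset (Fin n)) (t : ℕ) :
    (storageArcs S t : Set (DirPair n)) ⊆ edges n := by
  intro e he
  obtain ⟨w, -, rfl⟩ := Finset.mem_image.1 (Finset.mem_coe.1 he)
  exact Or.inr ⟨rfl, rfl⟩

lemma frontPath_subset_edges (T : ℕ) : (frontPath v₀ k T : Set (DirPair n)) ⊆ edges n := by
  induction T with
  | zero => exact horizontalPath_subset_edges _ _ _
  | succ T ih =>
    simp only [frontPath, Finset.coe_union]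
    exact Set.union_subset ih (Set.union_subset (storageArcs_subset_edges _ _)
      (horizontalPath_subset_edges _ _ _))

lemma frontPath_mono {T T' : ℕ} (h : T ≤ T') : frontPath v₀ k T ⊆ frontPath v₀ k T' := by
  induction T', h using Nat.le_induction with
  | base => exact Finset.Subset.refl _
  | succ T' _ ih => exact ih.trans Finset.subset_union_left

lemma card_frontPath_le (hv₀ : (v₀ : ℕ) = 0) (T : ℕ) (hn : front k T < n) :
    (frontPath v₀ k T).card ≤ front k T + T := by
  induction T with
  | zero =>
    refine (card_horizontalPath_le _ _ _).trans ?_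
    rw [node_val (by omega)]
    omega
  | succ T ih =>
    have hf := front_mono (k := k) (by omega : T ≤ T + 1)
    have h1 := ih (by omega)
    have h2 := card_horizontalPath_le (node v₀ (front k T)) (node v₀ (front k (T + 1))) (T + 1)
    rw [node_val (by omega), node_val (by omega)] at h2
    have h3 : (storageArcs {node v₀ (front k T)} T).card ≤ 1 :=
      Finset.card_image_le.trans (by simp)
    have h4 := Finset.card_union_le (storageArcs {node v₀ (front k T)} T)
      (horizontalPath (node v₀ (front k T)) (node v₀ (front k (T + 1))) (T + 1))
    refine (Finset.card_union_le _ _).trans ?_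
    omega

lemma horizontalPath_subset {u v w : Fin n} (h : v ≤ w) (t : ℕ) :
    horizontalPath u v t ⊆ horizontalPath u w t := by
  intro e he
  obtain ⟨p, hp, rfl⟩ := Finset.mem_image.1 he
  obtain ⟨-, h1, h2, h3⟩ := Finset.mem_filter.1 hp
  exact Finset.mem_image.2 ⟨p, Finset.mem_filter.2 ⟨Finset.mem_univ _, h1, h2, h3.trans h⟩, rfl⟩

lemma node_le_node {p q : ℕ} (h : p ≤ q) (hq : v₀ + q < n) : node v₀ p ≤ node v₀ q := by
  show (node v₀ p : ℕ) ≤ node v₀ q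
  rw [node_val (by omega), node_val hq]
  omega

/-- At each time the path along the front visits the positions that the front sweeps over. -/
lemma frontPath_reaches (s c : ℕ) (hn : v₀ + front k s < n) (hc : c ≤ front k s)
    (hs : 0 < s → front k (s - 1) ≤ c) : Reaches (frontPath v₀ k s) (v₀, 0) (node v₀ c, s) := by
  induction s generalizing c with
  | zero =>
    exact reaches_right 0 (le_node c) (horizontalPath_subset (node_le_node hc hn) 0)
  | succ s ih =>
    have hf := front_mono (k := k) (by omega : s ≤ s + 1)
    have h1 := ih (front k s) (by omega) le_rfl fun _ => front_mono (by omega)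
    refine (h1.mono Finset.subset_union_left).trans
      (Relation.ReflTransGen.head (b := (node v₀ (front k s), s + 1)) ?_ ?_)
    · exact Finset.mem_union_right _ (Finset.mem_union_left _
        (Finset.mem_image.2 ⟨_, Finset.mem_singleton_self _, rfl⟩))
    · refine reaches_right (s + 1) (node_le_node (hs (by omega)) (by omega)) ?_
      exact (horizontalPath_subset (node_le_node hc hn) (s + 1)).trans
        (Finset.subset_union_right.trans Finset.subset_union_right)

/-- The arcs that serve an attack on a level at time `t`, from the beginning of the period. -/
noncomputable def column (v₀ : Fin n) (k t : ℕ) : Option ℕ → Finset (DirPair n)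
  | none => ∅
  | some l => (Finset.Ico (periodStart k l t) t).image fun j =>
      ((node v₀ (base k l t), j), (node v₀ (base k l t), j + 1))

lemma card_column_le (hk : 1 ≤ k) (t : ℕ) (o : Option ℕ) : (column v₀ k t o).card ≤ pay k o := by
  rcases o with _ | l
  · simp [column]
  · refine Finset.card_image_le.trans ?_
    rw [Nat.card_Ico]
    have := le_periodStart_add hk l t
    show _ ≤ period k l
    omega

/-- The optimal solution may follow the front, and wait at the base for an attack. -/
lemma opt_attackRequests_le (hk : 1 ≤ k) (hv₀ : (v₀ : ℕ) = 0) (m : ℕ) (hn : front k (m + 1) < n) :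
    opt (attackRequests A k m) ≤ front k (m + 1) + (m + 1) +
      ∑ t ∈ Finset.range m, pay k (attacked A k t) := by
  classical
  set F := frontPath v₀ k (m + 1) ∪
    (Finset.range m).biUnion fun t => column v₀ k (t + 1) (attacked A k t) with hF
  have hfeas : IsFeasible (attackRequests A k m) F := by
    constructor
    · intro e he
      rcases Finset.mem_union.1 (Finset.mem_coe.1 he) with he | he
      · exact frontPath_subset_edges _ he
      · obtain ⟨t, -, he⟩ := Finset.mem_biUnion.1 he
        rcases h : attacked A k t with _ | l
        · rw [h] at he; simp [column] at he
        · rw [h] at he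
          obtain ⟨j, -, rfl⟩ := Finset.mem_image.1 he
          exact Or.inr ⟨rfl, rfl⟩
    · intro r hr
      rcases List.mem_append.1 hr with hr | hr
      · obtain ⟨t, ht, l, hl, rfl⟩ := mem_play hr
        have hlk := (attack_some hl).1
        have hs := periodStart_le (k := k) l (t + 1)
        have h1 : v₀ + front k (periodStart k l (t + 1)) < n := by
          have := front_mono (k := k) (hs.trans (by omega : t + 1 ≤ m + 1))
          omega
        have h2 := frontPath_reaches (v₀ := v₀) (k := k) (periodStart k l (t + 1))
          (base k l (t + 1)) h1 (base_le_front hk hlk _) (front_pred_le_base hk hlk _)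
        refine (h2.mono ((frontPath_mono (by omega)).trans Finset.subset_union_left)).trans
          (reaches_up _ hs fun j hj1 hj2 => Finset.mem_union_right _ (Finset.mem_biUnion.2
            ⟨t, Finset.mem_range.2 ht, ?_⟩))
        rw [hl]
        exact Finset.mem_image.2 ⟨j, Finset.mem_Ico.2 ⟨hj1, hj2⟩, rfl⟩
      · rw [List.mem_singleton.1 hr]
        exact (frontPath_reaches (m + 1) _ (by omega) le_rfl
          fun _ => front_mono (by omega)).mono Finset.subset_union_left
  have hopt : opt (attackRequests A k m) ≤ F.card := Nat.sInf_le ⟨F, hfeas, rfl⟩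
  refine hopt.trans ((Finset.card_union_le _ _).trans
    (Nat.add_le_add (card_frontPath_le hv₀ _ hn) ?_))
  exact Finset.card_biUnion_le.trans (Finset.sum_le_sum fun t _ => card_column_le hk _ _)

/-- The adversary with `k` levels forces a competitive ratio of at least `k / 4`. -/
lemma competitive_ge (hk : 1 ≤ k) (hv₀ : (v₀ : ℕ) = 0) {N : ℕ} (hn : 2 * (4 * k ^ 2) ^ k < n)
    (hN : 2 * (4 * k ^ 2) ^ k < N) {r : ℝ}
    (hA : ∀ R : Requests v₀, R.num ≤ N → ((A.cost R : ℕ) : ℝ) ≤ r * (opt R : ℝ)) :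
    (k : ℝ) ≤ 4 * r := by
  obtain ⟨m, hm⟩ : ∃ m, scale k k = m + 1 := ⟨scale k k - 1, by have := scale_pos hk k; omega⟩
  have hm' : (4 * k ^ 2) ^ k = m + 1 := hm
  have h4 : 4 ≤ m + 1 := by
    rw [← hm']
    calc 4 ≤ 4 * k ^ 2 := by have : 1 ≤ k ^ 2 := Nat.one_le_pow _ _ hk; omega
      _ ≤ _ := Nat.le_self_pow (by omega) _
  have hf := front_le hk (m + 1)
  have hfn : front k (m + 1) < n := by omega
  have h1 := sum_pay_le_cost (A := A) hk hv₀ m hfn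
  have h2 := opt_attackRequests_le (A := A) hk hv₀ m hfn
  have h3 := hA (attackRequests A k m) (by have := attackRequests_num_le (A := A) (k := k) m; omega)
  rw [Finset.sum_add_distrib, Finset.sum_const, Finset.card_range, smul_eq_mul,
    ← Finset.mul_sum] at h1
  set S := ∑ t ∈ Finset.range m, pay k (attacked A k t)
  set o := opt (attackRequests A k m)
  have h5 : (o : ℝ) ≤ 4 * m + S := by exact_mod_cast (by omega : o ≤ 4 * m + S)
  have h6 : (m : ℝ) * k + 2 * k * S ≤ r * o := le_trans (by exact_mod_cast h1) h3
  have hm3 : (3 : ℝ) ≤ m := by exact_mod_cast (by omega : 3 ≤ m)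
  have hk1 : (1 : ℝ) ≤ k := by exact_mod_cast hk
  have hkS : (0 : ℝ) ≤ k * S := by positivity
  have ho : (0 : ℝ) < o := by
    rcases Nat.eq_zero_or_pos o with h0 | h0
    · rw [h0, Nat.cast_zero, mul_zero] at h6
      nlinarith
    · exact_mod_cast h0
  refine le_of_mul_le_mul_right ?_ ho
  nlinarith [mul_le_mul_of_nonneg_left h5 (by linarith : (0 : ℝ) ≤ k)]

/-- A single request at the node next to the origin shows that no ratio is less than one. -/
lemma one_le_of_competitive {A : OnlineAlg v₀} (hv₀ : (v₀ : ℕ) = 0) (hn : 2 ≤ n) {N : ℕ}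
    (hN : 1 ≤ N) {r : ℝ}
    (hA : ∀ R : Requests v₀, R.num ≤ N → ((A.cost R : ℕ) : ℝ) ≤ r * (opt R : ℝ)) : 1 ≤ r := by
  have hval : (node v₀ 1 : ℕ) = 1 := by rw [node_val (by omega), hv₀]
  have h1 := hA ⟨[(target v₀ 1, 0)], by simp, by simp⟩ hN
  set R : Requests v₀ := ⟨[(target v₀ 1, 0)], by simp, by simp⟩
  have hopt : opt R ≤ 1 := by
    have hfeas : IsFeasible R (horizontalPath v₀ (node v₀ 1) 0) := by
      refine ⟨horizontalPath_subset_edges _ _ _, fun r hr => ?_⟩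
      rw [List.mem_singleton.1 hr]
      exact reaches_right 0 (le_node 1) (Finset.Subset.refl _)
    have h2 : opt R ≤ (horizontalPath v₀ (node v₀ 1) 0).card := Nat.sInf_le ⟨_, hfeas, rfl⟩
    have h3 := card_horizontalPath_le v₀ (node v₀ 1) 0
    omega
  have hcost : 1 ≤ A.cost R := by
    obtain ⟨u, -, hu, hsol⟩ := A.sol_request [] (target v₀ 1)
    have h2 : A.cost R = (A.sol ([] ++ [Event.request (target v₀ 1)])).card := rfl
    rw [A.sol_nil] at hu hsol
    have hu0 : u = v₀ := by
      rcases hu with hu | ⟨e, he, -⟩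
      · exact congrArg Prod.fst hu
      · simp at he
    rw [h2, hsol, Finset.empty_union, hu0]
    refine le_trans ?_ (le_card_horizontalPath _ _ _)
    show 1 ≤ (node v₀ 1 : ℕ) - v₀
    omega
  have h2 : (opt R : ℝ) ≤ 1 := by exact_mod_cast hopt
  have h3 : (1 : ℝ) ≤ A.cost R := by exact_mod_cast hcost
  have h4 : (0 : ℝ) ≤ opt R := Nat.cast_nonneg _
  rcases le_or_gt r 0 with hr | hr
  · have := mul_nonpos_of_nonpos_of_nonneg hr h4
    linarith
  · have := mul_le_mul_of_nonneg_left h2 hr.le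
    linarith

theorem exists_lower_bound : ∃ c : ℝ, 0 < c ∧
      ∀ (n N : ℕ), 3 ≤ n → 3 ≤ N → ∀ v₀ : Fin n, (v₀ : ℕ) = 0 →
        ∀ (A : OnlineAlg v₀) (ρ : ℝ),
          (∀ R : Requests v₀, R.num ≤ N → ((A.cost R : ℕ) : ℝ) ≤ ρ * (opt R : ℝ)) →
          c * min (logRatio N) (logRatio n) ≤ ρ := by
  refine ⟨1 / 128, by norm_num, fun n N hn hN v₀ hv₀ A r hA => ?_⟩
  have hmin : min (logRatio N) (logRatio n) ≤ logRatio (min N n) := by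
    rcases le_total N n with h | h
    · rw [min_eq_left h]; exact min_le_left _ _
    · rw [min_eq_right h]; exact min_le_right _ _
  rcases exists_levels (le_min hN hn) with h | ⟨k, hk, hlt, h⟩
  · have := one_le_of_competitive hv₀ (by omega) (by omega) hA
    linarith
  · have := competitive_ge hk hv₀ (hlt.trans_le (min_le_right _ _))
      (hlt.trans_le (min_le_left _ _)) hA
    have : (0 : ℝ) ≤ k := Nat.cast_nonneg _
    linarith

end DMCD

theorem mainTheorem5 :
    (∃ D : (n : ℕ) → (v₀ : Fin n) → DMCD.OnlineAlg v₀, ∃ C : ℝ, 0 < C ∧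
      ∀ (n : ℕ) (v₀ : Fin n) (R : DMCD.Requests v₀), 3 ≤ n → 3 ≤ R.num →
        (((D n v₀).cost R : ℕ) : ℝ) ≤
          C * min (DMCD.logRatio R.num) (DMCD.logRatio n) * (DMCD.opt R : ℝ)) ∧
    (∃ c : ℝ, 0 < c ∧
      ∀ (n N : ℕ) (hn : 3 ≤ n), 3 ≤ N →
        ∀ (A : DMCD.OnlineAlg (⟨0, by omega⟩ : Fin n)) (ρ : ℝ),
          (∀ R : DMCD.Requests (⟨0, by omega⟩ : Fin n), R.num ≤ N →
            ((A.cost R : ℕ) : ℝ) ≤ ρ * (DMCD.opt R : ℝ)) →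
          c * min (DMCD.logRatio N) (DMCD.logRatio n) ≤ ρ) := by
  obtain ⟨c, hc, h⟩ := DMCD.exists_lower_bound
  exact ⟨DMCD.exists_competitive, c, hc, fun n N hn hN => h n N hn hN _ rfl⟩
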